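/- Let $\ell,T>0$, $\rho,\mu\in L^\infty(0,\ell)$, $r,\kappa\in H^2(0,\ell)$ with $0<\rho_0\le\rho\le\rho_1$, $0\le\mu_0\le\mu\le\mu_1$, $0<r_0\le r\le r_1$, $0<\kappa_0\le\kappa\le\kappa_1$ on $(0,\ell)$. Let $\theta\in H^2(0,T)$ satisfy the compatibility condition $\theta(T)=0$. Then the backward problem $$\begin{cases}\rho\varphi_{tt}-\mu\varphi_t+(r\varphi_{xx})_{xx}-(\kappa\varphi_{xxt})_{xx}=0 & \text{in }(0,\ell)\times(0,T),\\ \varphi(x,T)=0,\quad \varphi_t(x,T)=0, & x\in(0,\ell),\\ \varphi(0,t)=0,\quad \varphi_x(0,t)=\theta(t), & t\in[0,T],\\ [r\varphi_{xx}-\kappa\varphi_{xxt}]_{x=\ell}=0,\quad [(-r\varphi_{xx}+\kappa\varphi_{xxt})_x]_{x=\ell}=0, & t\in[0,T],\end{cases}$$ has a weak solution $\varphi$ satisfying $$\|\varphi_t\|^2_{L^2(0,T;L^2(0,\ell))}\le 2\Big(C_6^2\,(e^{T/\rho_0}-1)+\tfrac{\ell^3}{3}\Big)G(\theta),$$ $$\|\varphi_{xx}\|^2_{L^2(0,T;L^2(0,\ell))}\le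 \frac{T\,C_6^2}{r_0}\,e^{T/\rho_0}\,G(\theta),\qquad \|\varphi_{xxt}\|^2_{L^2(0,T;L^2(0,\ell))}\le \frac{C_6^2}{2\kappa_0}\,e^{T/\rho_0}\,G(\theta),$$ where $G(\theta)=\|\theta'\|^2_{L^2(0,T)}+\|\theta''\|^2_{L^2(0,T)}$ and $C_6^2=\frac{2\ell^3}{3}\big(\max(\mu_1^2,\rho_1^2)+\rho_1\max(1/T,\,T/3)\big)$. Here $\varphi$ is a weak solution if $\varphi\in H^1(0,T;H^2(0,\ell))$ and $\varphi_t\in C([0,T];L^2(0,\ell))$; $\varphi(0,t)=0$ and $\varphi_x(0,t)=\theta(t)$ for all $t\in[0,T]$; $\varphi(\cdot,T)=0$ and $\varphi_t(\cdot,T)=0$; and for every $v\in H^2(0,\ell)$ with $v(0)=v_x(0)=0$ the function $t\mapsto(\rho\varphi_t(t),v)$ belongs to $H^1(0,T)$ and, with $(\cdot,\cdot)$ the inner product of $L^2(0,\ell)$, $$\tfrac{d}{dt}(\rho\varphi_t,v)-(\mu\varphi_t,v)+(r\varphi_{xx},v_{xx})-(\kappa\varphi_{xxt},v_{xx})=0\quad\text{for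 a.e. }t\in(0,T).$$ If moreover $\theta'(T)=0$, then for this $\varphi$ one has $\varphi_{tt}\in L^2(0,T;L^2(0,\ell))$ and, for every such $v$ and a.e. $t\in(0,T)$, $(\rho\varphi_{tt},v)-(\mu\varphi_t,v)+(r\varphi_{xx},v_{xx})-(\kappa\varphi_{xxt},v_{xx})=0$. -/

import Mathlib

open MeasureTheory Set

namespace Beam

/-- `u` belongs to the Sobolev space `H¹(a,b;X)` with derivative `u'`: the function `u` is the
continuous representative on `[a,b]`, its derivative `u'` lies in `L²(a,b;X)`, and `u` is the
(Bochner) primitive of `u'`. For `X = ℝ` this is the scalar space `H¹(a,b)`. -/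
structure IsH1 {X : Type*} [NormedAddCommGroup X] [NormedSpace ℝ X]
    (a b : ℝ) (u u' : ℝ → X) : Prop where
  memLp : MemLp u' 2 (volume.restrict (Ioo a b))
  eq_integral : ∀ t ∈ Icc a b, u t = u a + ∫ s in a..t, u' s

/-- The scalar function `f` belongs to `H²(a,b)`, with first derivative `f₁` (its continuous
representative) and second derivative `f₂`. -/
structure IsH2 (a b : ℝ) (f f₁ f₂ : ℝ → ℝ) : Prop where
  first : IsH1 a b f f₁
  second : IsH1 a b f₁ f₂

/-- The Hilbert space `L²(0,ℓ)`. -/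
abbrev L2 (ℓ : ℝ) : Type := Lp ℝ 2 (volume.restrict (Ioo (0 : ℝ) ℓ))

/-- The weighted pairing `(w f, g) = ∫₀^ℓ w f g dx`. -/
noncomputable def pairing (ℓ : ℝ) (w f g : ℝ → ℝ) : ℝ :=
  ∫ x in Ioo (0 : ℝ) ℓ, w x * f x * g x

/-- The test space `{v ∈ H²(0,ℓ) : v(0) = v_x(0) = 0}`, with the derivatives displayed. -/
structure IsTest (ℓ : ℝ) (v v₁ v₂ : ℝ → ℝ) : Prop where
  isH2 : IsH2 0 ℓ v v₁ v₂
  zero : v 0 = 0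
  deriv_zero : v₁ 0 = 0

/-- The assumptions on the coefficients of the beam equation. -/
structure Coefficients (ℓ : ℝ) (ρ μ r κ : ℝ → ℝ) (ρ₀ ρ₁ μ₀ μ₁ r₀ r₁ κ₀ κ₁ : ℝ) : Prop where
  rho_memLp : MemLp ρ ⊤ (volume.restrict (Ioo 0 ℓ))
  mu_memLp : MemLp μ ⊤ (volume.restrict (Ioo 0 ℓ))
  r_H2 : ∃ d₁ d₂ : ℝ → ℝ, IsH2 0 ℓ r d₁ d₂
  kappa_H2 : ∃ d₁ d₂ : ℝ → ℝ, IsH2 0 ℓ κ d₁ d₂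
  rho_pos : 0 < ρ₀
  mu_nonneg : 0 ≤ μ₀
  r_pos : 0 < r₀
  kappa_pos : 0 < κ₀
  rho_bounds : ∀ᵐ x ∂(volume.restrict (Ioo 0 ℓ)), ρ₀ ≤ ρ x ∧ ρ x ≤ ρ₁
  mu_bounds : ∀ᵐ x ∂(volume.restrict (Ioo 0 ℓ)), μ₀ ≤ μ x ∧ μ x ≤ μ₁
  r_bounds : ∀ x ∈ Ioo 0 ℓ, r₀ ≤ r x ∧ r x ≤ r₁
  kappa_bounds : ∀ x ∈ Ioo 0 ℓ, κ₀ ≤ κ x ∧ κ x ≤ κ₁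

/-- `φ` (with derivatives `φx, φxx, φt, φxt, φxxt`) is a weak solution of the backward problem
`ρ φ_tt - μ φ_t + (r φ_xx)_xx - (κ φ_xxt)_xx = 0` in `(0,ℓ) × (0,T)`,
`φ(·,T) = 0`, `φ_t(·,T) = 0`, `φ(0,t) = 0`, `φ_x(0,t) = θ(t)`,
`[r φ_xx - κ φ_xxt] = 0` and `[(-r φ_xx + κ φ_xxt)_x] = 0` at `x = ℓ`.
The first four fields say `φ ∈ H¹(0,T;H²(0,ℓ))`, together with the two essential boundary
conditions; the two conditions at `x = ℓ` are natural ones, contained in `weak_form`. -/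
structure IsWeakSolution (ℓ T : ℝ) (ρ μ r κ θ : ℝ → ℝ)
    (φ φx φxx φt φxt φxxt : ℝ → L2 ℓ) : Prop where
  time : IsH1 0 T φ φt
  time_x : IsH1 0 T φx φxt
  time_xx : IsH1 0 T φxx φxxt
  /-- For every `t` the function `φ(·,t)` has a representative `F` in `H²(0,ℓ)` with
  `F_x = φx(t)`, `F_xx = φxx(t)`, `F(0) = 0` and `F_x(0) = θ(t)`. -/
  space : ∀ t ∈ Icc 0 T, ∃ F F₁ : ℝ → ℝ, IsH2 0 ℓ F F₁ (φxx t) ∧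
    F =ᵐ[volume.restrict (Ioo 0 ℓ)] (φ t) ∧ F₁ =ᵐ[volume.restrict (Ioo 0 ℓ)] (φx t) ∧
    F 0 = 0 ∧ F₁ 0 = θ t
  /-- `φ_t ∈ C([0,T];L²(0,ℓ))`. -/
  continuousOn_t : ContinuousOn φt (Icc 0 T)
  terminal : φ T = 0
  terminal_t : φt T = 0
  /-- `d/dt (ρ φ_t, v) = (μ φ_t, v) - (r φ_xx, v_xx) + (κ φ_xxt, v_xx)` on `(0,T)`. -/
  weak_form : ∀ v v₁ v₂ : ℝ → ℝ, IsTest ℓ v v₁ v₂ →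
    IsH1 0 T (fun t => pairing ℓ ρ (φt t) v)
      (fun t => pairing ℓ μ (φt t) v - pairing ℓ r (φxx t) v₂ + pairing ℓ κ (φxxt t) v₂)

/-- `φ_tt` exists in `L²(0,T;L²(0,ℓ))` and, for every test function `v` and almost every `t`,
`(ρ φ_tt, v) - (μ φ_t, v) + (r φ_xx, v_xx) - (κ φ_xxt, v_xx) = 0`. -/
def HasL2Acceleration (ℓ T : ℝ) (ρ μ r κ : ℝ → ℝ) (φxx φt φxxt : ℝ → L2 ℓ) : Prop :=
  ∃ φtt : ℝ → L2 ℓ, IsH1 0 T φt φtt ∧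
    ∀ v v₁ v₂ : ℝ → ℝ, IsTest ℓ v v₁ v₂ → ∀ᵐ t ∂(volume.restrict (Ioo 0 T)),
      pairing ℓ ρ (φtt t) v - pairing ℓ μ (φt t) v + pairing ℓ r (φxx t) v₂
        - pairing ℓ κ (φxxt t) v₂ = 0

/-- The constant `C² = (2ℓ³/3) (max(μ₁², ρ₁²) + ρ₁ max(1/T, T/3))`. -/
noncomputable def C6sq (ℓ T ρ₁ μ₁ : ℝ) : ℝ :=
  2 * ℓ ^ 3 / 3 * (max (μ₁ ^ 2) (ρ₁ ^ 2) + ρ₁ * max (1 / T) (T / 3))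

/-- `G(θ) = ‖θ'‖² + ‖θ''‖²` in `L²(0,T)`, in terms of the two derivatives of `θ`. -/
noncomputable def G (T : ℝ) (θ₁ θ₂ : ℝ → ℝ) : ℝ :=
  (∫ t in (0 : ℝ)..T, θ₁ t ^ 2) + ∫ t in (0 : ℝ)..T, θ₂ t ^ 2

end Beam

/-! Put `φ(t) = x θ(t) + w(T - t)`. The lift `x θ` carries both essential boundary conditions and
has no second space derivative, so `w` solves a forward damped beam equation with homogeneous
conditions at `x = 0`, load `μ x θ' - ρ x θ''` (at time `T - s`), zero initial position because
`θ(T) = 0`, and initial velocity `θ'(T) x`.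

The unknown is `Z = w_xx`. Double integration `K` recovers `w = K Z`, and its range is the test
space, so the weak form becomes an equation in `L²` with bounded operators only: `K* P K Z'' + K* Q
K Z' + R Z + C Z' = K* F`. The operator `K* P K` is not bounded below, so `ε Z''` is added. The
result is a linear ODE with a bounded generator, solvable by an exponential (`exists_regularized`);
no Galerkin basis is needed.

Two energy estimates control `ε → 0`. Testing with `Z'` gives stability with respect to data and
residual (`energy_le`, `stability`), the strong damping absorbing the residual. Testing with `Z''`
bounds `ε ∫ ‖Z''‖²` (`acceleration_le`), so the residual `-ε Z''` tends to zero in `L²`. By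
linearity the approximations form a Cauchy sequence, and their strong limit satisfies both the weak
equation and the energy inequality (`exists_weakFlow`).

The explicit bounds are Gronwall's inequality applied to that energy inequality
(`IsWeakFlow.bounds`), with data of size `C6sq * G` (`data_le`). The profile `x` has slope one at
`0`, so it lies only in the closure of the range of `K`. If `θ'(T) = 0` the initial velocity
vanishes, the second estimate is uniform, and the acceleration survives as a weak limit. -/

open Filter Topology

set_option linter.unusedSectionVars false

namespace Beam

/-! ### Linear ODEs, Gronwall's inequality and square integrable functions on an interval -/

section Tools

variable {E : Type*} [NormedAddCommGroup E] [NormedSpace ℝ E]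

/-- Solvability of the linear equation `u' = L u + f` by the variation of constants formula. -/
theorem exists_linear_ode [CompleteSpace E] (L : E →L[ℝ] E) {f : ℝ → E} (hf : Continuous f)
    (u₀ : E) : ∃ u : ℝ → E, u 0 = u₀ ∧ ∀ t, HasDerivAt u (L (u t) + f t) t := by
  let _ : NormedAlgebra ℚ (E →L[ℝ] E) := .restrictScalars ℚ ℝ _
  let V : ℝ → E →L[ℝ] E := fun t => NormedSpace.exp (t • L)
  let W : ℝ → E →L[ℝ] E := fun t => NormedSpace.exp (-(t • L))
  have hV : ∀ t, HasDerivAt V (L * V t) t := fun t => hasDerivAt_exp_smul_const' (𝕂 := ℝ) L t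
  have hWc : Continuous W :=
    NormedSpace.exp_continuous.comp ((continuous_id.smul continuous_const).neg)
  have hWV : ∀ t, V t * W t = 1 := fun t => by
    have := NormedSpace.exp_add_of_commute (x := t • L) (y := -(t • L)) (Commute.neg_right rfl)
    simp only [add_neg_cancel, NormedSpace.exp_zero] at this
    exact this.symm
  have hc : Continuous fun s => W s (f s) := hWc.clm_apply hf
  refine ⟨fun t => V t (u₀ + ∫ s in (0 : ℝ)..t, W s (f s)), by simp [V], fun t => ?_⟩
  have hI : HasDerivAt (fun t => u₀ + ∫ s in (0 : ℝ)..t, W s (f s)) (W t (f t)) t :=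
    (intervalIntegral.integral_hasDerivAt_right (hc.intervalIntegrable _ _)
      (hc.stronglyMeasurableAtFilter _ _) hc.continuousAt).const_add _
  convert (hV t).clm_apply hI using 1
  have := congrArg (fun B : E →L[ℝ] E => B (f t)) (hWV t)
  simp only [mul_apply_eq_comp, one_apply_eq_self] at this
  rw [this]; rfl

/-- Gronwall's inequality in integral form. -/
theorem gronwall_integral {m : ℝ → ℝ} {a ρ T : ℝ} (hρ : 0 < ρ)
    (hm : ContinuousOn m (Icc 0 T)) (h : ∀ s ∈ Icc 0 T, ρ * m s ≤ a + ∫ τ in (0 : ℝ)..s, m τ) :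
    ∀ s ∈ Icc 0 T, ∫ τ in (0 : ℝ)..s, m τ ≤ a * (Real.exp (s / ρ) - 1) := by
  intro s hs
  have hT : (0 : ℝ) ≤ T := hs.1.trans hs.2
  have hint : IntervalIntegrable m volume 0 T := by
    apply ContinuousOn.intervalIntegrable; rwa [uIcc_of_le hT]
  have hI : ContinuousOn (fun s => ∫ τ in (0 : ℝ)..s, m τ) (Icc 0 T) := by
    have := intervalIntegral.continuousOn_primitive_interval'
      (μ := volume) (f := m) (a := 0) (b₁ := 0) (b₂ := T) hint (by simp)
    rwa [uIcc_of_le hT] at this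
  -- Since `m` need not be differentiable, Gronwall is applied to its primitive `I`, which satisfies
  -- `I 0 = 0` and `I' = m ≤ I / ρ + a / ρ`.
  have key := le_gronwallBound_of_liminf_deriv_right_le (f := fun s => ∫ τ in (0 : ℝ)..s, m τ)
    (f' := m) (δ := 0) (K := 1 / ρ) (ε := a / ρ) (a := 0) (b := T) hI ?_ (by simp)
    (fun x hx => by
      have := h x ⟨hx.1, hx.2.le⟩
      rw [one_div_mul_eq_div, ← add_div, le_div_iff₀ hρ]
      linarith) s hs
  · rw [sub_zero, gronwallBound_of_K_ne_0 (one_div_pos.2 hρ).ne'] at key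
    refine key.trans_eq ?_
    beta_reduce
    rw [one_div_mul_eq_div]
    field_simp
    ring
  · intro x hx r hr
    refine HasDerivWithinAt.liminf_right_slope_le ?_ hr
    have hx' : x ∈ Icc 0 T := ⟨hx.1, hx.2.le⟩
    have hcw : ContinuousWithinAt m (Icc x T) x := (hm x hx').mono (Icc_subset_Icc_left hx.1)
    have hi : IntervalIntegrable m volume 0 x := hint.mono_set (by
      rw [uIcc_of_le hT, uIcc_of_le hx.1]; exact Icc_subset_Icc_right hx.2.le)
    have hnh : 𝓝[>] x ≤ 𝓝[Icc x T] x := by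
      rw [← nhdsWithin_Ioc_eq_nhdsGT hx.2]; exact nhdsWithin_mono _ Ioc_subset_Icc_self
    have hsm : StronglyMeasurableAtFilter m (𝓝[>] x) volume :=
      ⟨Ioc x T, Ioc_mem_nhdsGT hx.2, ((hm.mono (fun y hy =>
        ⟨hx.1.trans hy.1.le, hy.2⟩)).aestronglyMeasurable measurableSet_Ioc)⟩
    exact intervalIntegral.integral_hasDerivWithinAt_right (s := Ici x) hi hsm
      (hcw.mono_left hnh)

/-- The Cauchy–Schwarz inequality for interval integrals. -/
theorem sq_integral_mul_le {f g : ℝ → ℝ} {s : ℝ} (hs : 0 ≤ s)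
    (hf : IntervalIntegrable (fun t => f t ^ 2) volume 0 s)
    (hg : IntervalIntegrable (fun t => g t ^ 2) volume 0 s)
    (hfg : IntervalIntegrable (fun t => f t * g t) volume 0 s) :
    (∫ t in (0 : ℝ)..s, f t * g t) ^ 2 ≤
      (∫ t in (0 : ℝ)..s, f t ^ 2) * ∫ t in (0 : ℝ)..s, g t ^ 2 := by
  -- The integral of `(x f + g)²` is a nonnegative quadratic in `x`; its discriminant gives the
  -- inequality.
  have h : ∀ x : ℝ, 0 ≤ (∫ t in (0 : ℝ)..s, f t ^ 2) * (x * x)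
      + (2 * ∫ t in (0 : ℝ)..s, f t * g t) * x + ∫ t in (0 : ℝ)..s, g t ^ 2 := fun x => by
    have h0 : 0 ≤ ∫ t in (0 : ℝ)..s, (x ^ 2 * f t ^ 2 + 2 * x * (f t * g t) + g t ^ 2) :=
      intervalIntegral.integral_nonneg hs fun t _ => by nlinarith [sq_nonneg (x * f t + g t)]
    rw [intervalIntegral.integral_add ((hf.const_mul _).add (hfg.const_mul _)) hg,
      intervalIntegral.integral_add (hf.const_mul _) (hfg.const_mul _),
      intervalIntegral.integral_const_mul, intervalIntegral.integral_const_mul] at h0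
    linarith
  have := discrim_le_zero h
  rw [discrim] at this
  linarith

/-- The Cauchy–Schwarz inequality against the constant function. -/
theorem sq_integral_le {f : ℝ → ℝ} {s : ℝ} (hs : 0 ≤ s) (h1 : IntervalIntegrable f volume 0 s)
    (h2 : IntervalIntegrable (fun t => f t ^ 2) volume 0 s) :
    (∫ t in (0 : ℝ)..s, f t) ^ 2 ≤ s * ∫ t in (0 : ℝ)..s, f t ^ 2 := by
  have := sq_integral_mul_le (f := fun _ => 1) hs (by simp) h2 (by simpa using h1)
  simpa using this

variable {T : ℝ}

theorem intervalIntegrable_of_integrableOn_Ioo {f : ℝ → E}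
    (hf : Integrable f (volume.restrict (Ioo 0 T))) {s : ℝ} (hs : s ∈ Icc 0 T) :
    IntervalIntegrable f volume 0 s := by
  rw [intervalIntegrable_iff_integrableOn_Ioo_of_le hs.1]
  exact IntegrableOn.mono_set hf (Ioo_subset_Ioo_right hs.2)

theorem MemLp.intervalIntegrable_two {f : ℝ → E} (hf : MemLp f 2 (volume.restrict (Ioo 0 T)))
    {s : ℝ} (hs : s ∈ Icc 0 T) : IntervalIntegrable f volume 0 s :=
  intervalIntegrable_of_integrableOn_Ioo (hf.integrable (by norm_num)) hs

theorem MemLp.intervalIntegrable_norm_sq {f : ℝ → E}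
    (hf : MemLp f 2 (volume.restrict (Ioo 0 T))) {s : ℝ} (hs : s ∈ Icc 0 T) :
    IntervalIntegrable (fun t => ‖f t‖ ^ 2) volume 0 s :=
  intervalIntegrable_of_integrableOn_Ioo hf.integrable_norm_pow' hs

theorem memLp_two_of_continuousOn {f : ℝ → E} (hf : ContinuousOn f (Icc 0 T)) :
    MemLp f 2 (volume.restrict (Ioo 0 T)) := by
  obtain ⟨C, hC⟩ := isCompact_Icc.exists_bound_of_continuousOn hf
  exact MemLp.of_bound ((hf.mono Ioo_subset_Icc_self).aestronglyMeasurable measurableSet_Ioo) C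
    ((ae_restrict_iff' measurableSet_Ioo).2 (.of_forall fun x hx => hC x (Ioo_subset_Icc_self hx)))

theorem continuousOn_primitive {f : ℝ → E} (hf : MemLp f 2 (volume.restrict (Ioo 0 T)))
    (hT : 0 ≤ T) : ContinuousOn (fun s => ∫ t in (0 : ℝ)..s, f t) (Icc 0 T) := by
  have := intervalIntegral.continuousOn_primitive_interval'
    (μ := volume) (f := f) (a := 0) (b₁ := 0) (b₂ := T)
    (MemLp.intervalIntegrable_two hf ⟨hT, le_rfl⟩) (by simp)
  rwa [uIcc_of_le hT] at this

theorem sq_norm_integral_le {f : ℝ → E} (hf : MemLp f 2 (volume.restrict (Ioo 0 T)))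
    {s : ℝ} (hs : s ∈ Icc 0 T) :
    ‖∫ t in (0 : ℝ)..s, f t‖ ^ 2 ≤ T * ∫ t in (0 : ℝ)..T, ‖f t‖ ^ 2 := by
  have hT : T ∈ Icc 0 T := ⟨hs.1.trans hs.2, le_rfl⟩
  calc ‖∫ t in (0 : ℝ)..s, f t‖ ^ 2 ≤ (∫ t in (0 : ℝ)..s, ‖f t‖) ^ 2 := by
        gcongr; exact intervalIntegral.norm_integral_le_integral_norm hs.1
    _ ≤ s * ∫ t in (0 : ℝ)..s, ‖f t‖ ^ 2 := sq_integral_le hs.1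
        (MemLp.intervalIntegrable_two hf hs).norm (MemLp.intervalIntegrable_norm_sq hf hs)
    _ ≤ T * ∫ t in (0 : ℝ)..T, ‖f t‖ ^ 2 := by
        gcongr
        · exact intervalIntegral.integral_nonneg hs.1 fun _ _ => by positivity
        · exact hT.1
        · exact hs.2
        · exact intervalIntegral.integral_mono_interval le_rfl hs.1 hs.2
            (.of_forall fun _ => by positivity) (MemLp.intervalIntegrable_norm_sq hf hT)

theorem integral_norm_sq_mono {f : ℝ → E} (hf : MemLp f 2 (volume.restrict (Ioo 0 T)))
    {s : ℝ} (hs : s ∈ Icc 0 T) :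
    ∫ t in (0 : ℝ)..s, ‖f t‖ ^ 2 ≤ ∫ t in (0 : ℝ)..T, ‖f t‖ ^ 2 :=
  intervalIntegral.integral_mono_interval le_rfl hs.1 hs.2
    (.of_forall fun _ => by positivity)
    (MemLp.intervalIntegrable_norm_sq hf ⟨hs.1.trans hs.2, le_rfl⟩)

end Tools

/-! ### Strong and weak limits in Hilbert spaces -/

section Hilbert

variable {E : Type*} [NormedAddCommGroup E] [InnerProductSpace ℝ E] {T : ℝ}

theorem norm_toLp_sq {α : Type*} [MeasurableSpace α] {μ : Measure α} {f : α → E}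
    (hf : MemLp f 2 μ) : ‖hf.toLp f‖ ^ 2 = ∫ t, ‖f t‖ ^ 2 ∂μ := by
  rw [← real_inner_self_eq_norm_sq, L2.inner_def]
  refine integral_congr_ae ?_
  filter_upwards [hf.coeFn_toLp] with t ht
  rw [ht, real_inner_self_eq_norm_sq]

theorem norm_toLp_sq_interval (hT : 0 ≤ T) {f : ℝ → E}
    (hf : MemLp f 2 (volume.restrict (Ioo 0 T))) :
    ‖hf.toLp f‖ ^ 2 = ∫ t in (0 : ℝ)..T, ‖f t‖ ^ 2 := by
  rw [norm_toLp_sq, intervalIntegral.integral_of_le hT, integral_Ioc_eq_integral_Ioo]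

/-- Completeness of `L²(0,T;E)`, in terms of integrals of functions. -/
theorem exists_L2_limit [CompleteSpace E] (hT : 0 ≤ T) {Y : ℕ → ℝ → E}
    (hY : ∀ n, MemLp (Y n) 2 (volume.restrict (Ioo 0 T)))
    (hC : ∀ ε > 0, ∃ N, ∀ m ≥ N, ∀ n ≥ N, ∫ t in (0 : ℝ)..T, ‖Y m t - Y n t‖ ^ 2 ≤ ε) :
    ∃ y : ℝ → E, MemLp y 2 (volume.restrict (Ioo 0 T)) ∧
      Tendsto (fun n => ∫ t in (0 : ℝ)..T, ‖Y n t - y t‖ ^ 2) atTop (𝓝 0) := by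
  have hcs : CauchySeq fun n => (hY n).toLp (Y n) := by
    rw [Metric.cauchySeq_iff]
    intro ε hε
    obtain ⟨N, hN⟩ := hC ((ε / 2) ^ 2) (by positivity)
    refine ⟨N, fun m hm n hn => ?_⟩
    have := hN m hm n hn
    have h2 := norm_toLp_sq_interval hT ((hY m).sub (hY n))
    simp only [Pi.sub_apply] at h2
    rw [← h2, MemLp.toLp_sub (hY m) (hY n)] at this
    rw [dist_eq_norm]
    have := abs_le_of_sq_le_sq this (by positivity)
    rw [abs_of_nonneg (norm_nonneg _)] at this
    linarith
  obtain ⟨y, hy⟩ := cauchySeq_tendsto_of_complete hcs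
  refine ⟨y, Lp.memLp y, ?_⟩
  have h1 := (tendsto_iff_norm_sub_tendsto_zero.1 hy).pow 2
  rw [zero_pow two_ne_zero] at h1
  refine h1.congr fun n => ?_
  have h2 := norm_toLp_sq_interval hT ((hY n).sub (Lp.memLp y))
  simp only [Pi.sub_apply] at h2
  rw [← h2, MemLp.toLp_sub (hY n) (Lp.memLp y), Lp.toLp_coeFn]

/-- Convergence in `L²(0,T;E)` implies convergence of the primitives. -/
theorem tendsto_integral_of_L2 [CompleteSpace E] {Y : ℕ → ℝ → E} {y : ℝ → E}
    (hY : ∀ n, MemLp (Y n) 2 (volume.restrict (Ioo 0 T)))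
    (hy : MemLp y 2 (volume.restrict (Ioo 0 T)))
    (h : Tendsto (fun n => ∫ t in (0 : ℝ)..T, ‖Y n t - y t‖ ^ 2) atTop (𝓝 0))
    {s : ℝ} (hs : s ∈ Icc 0 T) :
    Tendsto (fun n => ∫ t in (0 : ℝ)..s, Y n t) atTop (𝓝 (∫ t in (0 : ℝ)..s, y t)) := by
  rw [tendsto_iff_norm_sub_tendsto_zero]
  have h1 : Tendsto (fun n => √(T * ∫ t in (0 : ℝ)..T, ‖Y n t - y t‖ ^ 2)) atTop (𝓝 0) := by
    have := ((h.const_mul T).sqrt); simpa using this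
  refine squeeze_zero (fun _ => norm_nonneg _) (fun n => ?_) h1
  rw [← intervalIntegral.integral_sub (MemLp.intervalIntegrable_two (hY n) hs)
    (MemLp.intervalIntegrable_two hy hs)]
  exact Real.le_sqrt_of_sq_le (sq_norm_integral_le ((hY n).sub hy) hs)

/-- Convergence in `L²(0,T;E)` implies convergence of the squared norms over subintervals. -/
theorem tendsto_integral_norm_sq_of_L2 {Y : ℕ → ℝ → E} {y : ℝ → E}
    (hY : ∀ n, MemLp (Y n) 2 (volume.restrict (Ioo 0 T)))
    (hy : MemLp y 2 (volume.restrict (Ioo 0 T)))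
    (h : Tendsto (fun n => ∫ t in (0 : ℝ)..T, ‖Y n t - y t‖ ^ 2) atTop (𝓝 0))
    {s : ℝ} (hs : s ∈ Icc 0 T) :
    Tendsto (fun n => ∫ t in (0 : ℝ)..s, ‖Y n t‖ ^ 2) atTop
      (𝓝 (∫ t in (0 : ℝ)..s, ‖y t‖ ^ 2)) := by
  have hr : ∀ {f : ℝ → E}, MemLp f 2 (volume.restrict (Ioo 0 T)) →
      MemLp f 2 (volume.restrict (Ioo 0 s)) := fun hf =>
    hf.mono_measure (Measure.restrict_mono (Ioo_subset_Ioo_right hs.2) le_rfl)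
  have h1 : Tendsto (fun n => ‖(hr (hY n)).toLp (Y n) - (hr hy).toLp y‖ ^ 2) atTop (𝓝 0) := by
    refine squeeze_zero (fun _ => by positivity) (fun n => ?_) h
    have h2 := norm_toLp_sq_interval hs.1 ((hr (hY n)).sub (hr hy))
    rw [← MemLp.toLp_sub, h2]
    exact integral_norm_sq_mono ((hY n).sub hy) hs
  have h2 : Tendsto (fun n => (hr (hY n)).toLp (Y n)) atTop (𝓝 ((hr hy).toLp y)) := by
    rw [tendsto_iff_norm_sub_tendsto_zero]
    simpa [Real.sqrt_sq (norm_nonneg _)] using h1.sqrt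
  simpa only [norm_toLp_sq_interval hs.1] using (h2.norm.pow 2)

/-- Weak compactness of bounded sequences in a Hilbert space, along an ultrafilter. -/
theorem exists_weak_limit [CompleteSpace E] {v : ℕ → E} {C : ℝ} (hv : ∀ n, ‖v n‖ ≤ C) :
    ∃ w : E, ∀ z : E, Tendsto (fun n => inner ℝ (v n) z) (hyperfilter ℕ) (𝓝 (inner ℝ w z)) := by
  let f : ℕ → WeakDual ℝ E := fun n => StrongDual.toWeakDual (InnerProductSpace.toDual ℝ E (v n))
  -- Banach–Alaoglu: an ultrafilter on a weak-* compact ball converges, so neither separability nor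
  -- a subsequence is needed.
  have hK := WeakDual.isCompact_closedBall (𝕜 := ℝ) (0 : StrongDual ℝ E) C
  obtain ⟨w, -, hw⟩ := hK.ultrafilter_le_nhds ((hyperfilter ℕ : Ultrafilter ℕ).map f) (by
    rw [le_principal_iff]
    refine Filter.mem_map.2 (univ_mem' fun n => ?_)
    have : ‖InnerProductSpace.toDual ℝ E (v n)‖ ≤ C := by simpa using hv n
    simpa [f] using this)
  refine ⟨(InnerProductSpace.toDual ℝ E).symm (WeakDual.toStrongDual w), fun z => ?_⟩
  rw [InnerProductSpace.toDual_symm_apply]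
  exact ((WeakDual.eval_continuous z).tendsto w).comp hw

end Hilbert

/-- A function whose primitive vanishes on `[0,T]` is zero almost everywhere. -/
theorem ae_eq_zero_of_primitive {f : ℝ → ℝ} {T : ℝ} (hT : 0 ≤ T)
    (hf : Integrable f (volume.restrict (Ioo 0 T)))
    (h : ∀ s ∈ Icc 0 T, ∫ t in (0 : ℝ)..s, f t = 0) :
    ∀ᵐ t ∂(volume.restrict (Ioo 0 T)), f t = 0 := by
  have hint := intervalIntegrable_of_integrableOn_Ioo hf (right_mem_Icc.2 hT)
  have h1 := IntervalIntegrable.ae_hasDerivAt_integral hint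
  rw [ae_restrict_iff' measurableSet_Ioo]
  filter_upwards [h1] with x hx hxT
  rw [uIcc_of_le hT] at hx
  have h2 := hx (Ioo_subset_Icc_self hxT) 0 (left_mem_Icc.2 hT)
  have h3 : HasDerivAt (fun s => ∫ t in (0 : ℝ)..s, f t) 0 x := by
    refine (hasDerivAt_const x (0 : ℝ)).congr_of_eventuallyEq ?_
    filter_upwards [Ioo_mem_nhds hxT.1 hxT.2] with y hy using h y (Ioo_subset_Icc_self hy)
  exact h2.unique h3

/-! ### The abstract damped equation and its energy estimates -/

/-- The bounded operators of an abstract second order equation with strong damping,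
`(P K Z'', K ζ) + (Q K Z', K ζ) + (R Z, ζ) + (C Z', ζ) = (F, K ζ)` for all `ζ`. The space of
states is parametrised by `K : X → H`. -/
structure DampedSystem (X H : Type*) [NormedAddCommGroup X] [InnerProductSpace ℝ X]
    [NormedAddCommGroup H] [InnerProductSpace ℝ H] where
  K : X →L[ℝ] H
  P : H →L[ℝ] H
  Q : H →L[ℝ] H
  R : X →L[ℝ] X
  C : X →L[ℝ] X
  ρ₀ : ℝ
  r₀ : ℝ
  κ₀ : ℝ
  ρ₀_pos : 0 < ρ₀
  r₀_pos : 0 < r₀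
  κ₀_pos : 0 < κ₀
  P_symm : ∀ x y, inner ℝ (P x) y = inner ℝ x (P y)
  P_coercive : ∀ x, ρ₀ * ‖x‖ ^ 2 ≤ inner ℝ (P x) x
  Q_nonneg : ∀ x, 0 ≤ inner ℝ (Q x) x
  R_symm : ∀ x y, inner ℝ (R x) y = inner ℝ x (R y)
  R_coercive : ∀ x, r₀ * ‖x‖ ^ 2 ≤ inner ℝ (R x) x
  C_symm : ∀ x y, inner ℝ (C x) y = inner ℝ x (C y)
  C_coercive : ∀ x, κ₀ * ‖x‖ ^ 2 ≤ inner ℝ (C x) x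

namespace DampedSystem

variable {X H : Type*} [NormedAddCommGroup X] [InnerProductSpace ℝ X]
  [NormedAddCommGroup H] [InnerProductSpace ℝ H]

/-- `Z`, with `Z' = Y` and `Z'' = Y'`, is a classical solution with load `F` and residual `g`. -/
structure IsFlow (S : DampedSystem X H) (F : ℝ → H) (g Z Y Y' : ℝ → X) : Prop where
  deriv_Z : ∀ s, HasDerivAt Z (Y s) s
  deriv_Y : ∀ s, HasDerivAt Y (Y' s) s
  cont_Y' : Continuous Y'
  cont_F : Continuous F
  cont_g : Continuous g
  zero : Z 0 = 0
  eqn : ∀ s ζ, inner ℝ (S.P (S.K (Y' s))) (S.K ζ) + inner ℝ (S.Q (S.K (Y s))) (S.K ζ)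
    + inner ℝ (S.R (Z s)) ζ + inner ℝ (S.C (Y s)) ζ = inner ℝ (F s) (S.K ζ) + inner ℝ (g s) ζ

variable {S : DampedSystem X H} {F F₂ : ℝ → H} {g g₂ Z Z₂ Y Y₂ Y' Y₂' : ℝ → X} {T : ℝ}

namespace IsFlow

theorem cont_Z (h : S.IsFlow F g Z Y Y') : Continuous Z :=
  continuous_iff_continuousAt.2 fun s => (h.deriv_Z s).continuousAt

theorem cont_Y (h : S.IsFlow F g Z Y Y') : Continuous Y :=
  continuous_iff_continuousAt.2 fun s => (h.deriv_Y s).continuousAt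

/-- The residual is arbitrary in `IsFlow` precisely so that differences are again flows, even when
the two regularisation parameters differ; stability then compares any two approximations. -/
theorem sub (h : S.IsFlow F g Z Y Y') (h₂ : S.IsFlow F₂ g₂ Z₂ Y₂ Y₂') :
    S.IsFlow (fun s => F s - F₂ s) (fun s => g s - g₂ s) (fun s => Z s - Z₂ s)
      (fun s => Y s - Y₂ s) (fun s => Y' s - Y₂' s) where
  deriv_Z s := (h.deriv_Z s).sub (h₂.deriv_Z s)
  deriv_Y s := (h.deriv_Y s).sub (h₂.deriv_Y s)
  cont_Y' := h.cont_Y'.sub h₂.cont_Y'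
  cont_F := h.cont_F.sub h₂.cont_F
  cont_g := h.cont_g.sub h₂.cont_g
  zero := by simp [h.zero, h₂.zero]
  eqn s ζ := by
    have e₁ := h.eqn s ζ
    have e₂ := h₂.eqn s ζ
    simp only [map_sub, inner_sub_left]
    linarith

theorem Z_eq_integral [CompleteSpace X] (h : S.IsFlow F g Z Y Y') (s : ℝ) :
    Z s = ∫ t in (0 : ℝ)..s, Y t := by
  rw [intervalIntegral.integral_eq_sub_of_hasDerivAt (fun t _ => h.deriv_Z t)
    (h.cont_Y.intervalIntegrable _ _), h.zero, sub_zero]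

/-- The energy balance, with Young's inequality applied to the load. -/
theorem energy_le (h : S.IsFlow F g Z Y Y') {s : ℝ} (hs : 0 ≤ s) :
    inner ℝ (S.P (S.K (Y s))) (S.K (Y s)) + inner ℝ (S.R (Z s)) (Z s)
      + 2 * S.κ₀ * ∫ t in (0 : ℝ)..s, ‖Y t‖ ^ 2 ≤
    inner ℝ (S.P (S.K (Y 0))) (S.K (Y 0)) + (∫ t in (0 : ℝ)..s, ‖F t‖ ^ 2)
      + (∫ t in (0 : ℝ)..s, ‖S.K (Y t)‖ ^ 2) + 2 * ∫ t in (0 : ℝ)..s, inner ℝ (g t) (Y t) := by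
  have hZ := h.cont_Z
  have hY := h.cont_Y
  have hF := h.cont_F
  have hg := h.cont_g
  have hY' := h.cont_Y'
  have hd : ∀ t, HasDerivAt
      (fun t => inner ℝ (S.P (S.K (Y t))) (S.K (Y t)) + inner ℝ (S.R (Z t)) (Z t))
      (2 * (inner ℝ (S.P (S.K (Y' t))) (S.K (Y t)) + inner ℝ (S.R (Z t)) (Y t))) t := by
    intro t
    have dKY : HasDerivAt (fun t => S.K (Y t)) (S.K (Y' t)) t :=
      S.K.hasFDerivAt.comp_hasDerivAt t (h.deriv_Y t)
    have dPKY : HasDerivAt (fun t => S.P (S.K (Y t))) (S.P (S.K (Y' t))) t :=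
      S.P.hasFDerivAt.comp_hasDerivAt t dKY
    have dRZ : HasDerivAt (fun t => S.R (Z t)) (S.R (Y t)) t :=
      S.R.hasFDerivAt.comp_hasDerivAt t (h.deriv_Z t)
    have := (dPKY.inner ℝ dKY).add (dRZ.inner ℝ (h.deriv_Z t))
    refine this.congr_deriv ?_
    rw [S.P_symm (S.K (Y t)), real_inner_comm (S.P (S.K (Y' t))), S.R_symm (Y t),
      real_inner_comm (S.R (Z t)) (Y t)]
    ring
  have hcd : Continuous fun t =>
      2 * (inner ℝ (S.P (S.K (Y' t))) (S.K (Y t)) + inner ℝ (S.R (Z t)) (Y t)) := by fun_prop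
  have hftc := intervalIntegral.integral_eq_sub_of_hasDerivAt (fun t _ => hd t)
    (hcd.intervalIntegrable 0 s)
  have i₁ : IntervalIntegrable (fun t => ‖F t‖ ^ 2) volume 0 s :=
    (by fun_prop : Continuous fun t => ‖F t‖ ^ 2).intervalIntegrable _ _
  have i₂ : IntervalIntegrable (fun t => ‖S.K (Y t)‖ ^ 2) volume 0 s :=
    (by fun_prop : Continuous fun t => ‖S.K (Y t)‖ ^ 2).intervalIntegrable _ _
  have i₃ : IntervalIntegrable (fun t => (inner ℝ (g t) (Y t) : ℝ)) volume 0 s :=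
    (by fun_prop : Continuous fun t => (inner ℝ (g t) (Y t) : ℝ)).intervalIntegrable _ _
  have i₄ : IntervalIntegrable (fun t => ‖Y t‖ ^ 2) volume 0 s :=
    (by fun_prop : Continuous fun t => ‖Y t‖ ^ 2).intervalIntegrable _ _
  -- The equation is tested with `ζ = Y t`; the `Q` term has a good sign and is dropped, and `2 (F,
  -- K Y) ≤ ‖F‖² + ‖K Y‖²`.
  have hmono : ∫ t in (0 : ℝ)..s,
        2 * (inner ℝ (S.P (S.K (Y' t))) (S.K (Y t)) + inner ℝ (S.R (Z t)) (Y t)) ≤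
      ∫ t in (0 : ℝ)..s, (‖F t‖ ^ 2 + ‖S.K (Y t)‖ ^ 2 + 2 * inner ℝ (g t) (Y t)
        - 2 * S.κ₀ * ‖Y t‖ ^ 2) := by
    refine intervalIntegral.integral_mono_on hs (hcd.intervalIntegrable _ _)
      (((i₁.add i₂).add (i₃.const_mul 2)).sub (i₄.const_mul _)) fun t _ => ?_
    have e := h.eqn t (Y t)
    have c₁ := S.Q_nonneg (S.K (Y t))
    have c₂ := S.C_coercive (Y t)
    have c₃ := real_inner_le_norm (F t) (S.K (Y t))
    nlinarith [sq_nonneg (‖F t‖ - ‖S.K (Y t)‖)]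
  rw [hftc, intervalIntegral.integral_sub ((i₁.add i₂).add (i₃.const_mul 2)) (i₄.const_mul _),
    intervalIntegral.integral_add (i₁.add i₂) (i₃.const_mul 2),
    intervalIntegral.integral_add i₁ i₂, intervalIntegral.integral_const_mul,
    intervalIntegral.integral_const_mul, h.zero] at hmono
  simp only [map_zero, inner_zero_left, add_zero] at hmono
  linarith

/-- Stability: if the residual is controlled, so is the solution. -/
theorem stability (h : S.IsFlow F g Z Y Y') (hT : 0 ≤ T) {b : ℝ}
    (hb : ∀ s ∈ Icc 0 T, 2 * ∫ t in (0 : ℝ)..s, inner ℝ (g t) (Y t) ≤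
      b + S.κ₀ * ∫ t in (0 : ℝ)..s, ‖Y t‖ ^ 2) :
    (∀ s ∈ Icc 0 T, S.ρ₀ * ‖S.K (Y s)‖ ^ 2 ≤ (inner ℝ (S.P (S.K (Y 0))) (S.K (Y 0))
      + (∫ t in (0 : ℝ)..T, ‖F t‖ ^ 2) + b) * Real.exp (T / S.ρ₀)) ∧
    S.κ₀ * ∫ t in (0 : ℝ)..T, ‖Y t‖ ^ 2 ≤ (inner ℝ (S.P (S.K (Y 0))) (S.K (Y 0))
      + (∫ t in (0 : ℝ)..T, ‖F t‖ ^ 2) + b) * Real.exp (T / S.ρ₀) := by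
  set a := inner ℝ (S.P (S.K (Y 0))) (S.K (Y 0)) + (∫ t in (0 : ℝ)..T, ‖F t‖ ^ 2) + b
  have hY := h.cont_Y
  have hF := h.cont_F
  have hρ := S.ρ₀_pos
  have hcm : Continuous fun t => ‖S.K (Y t)‖ ^ 2 := by fun_prop
  -- Half of the dissipation `2 κ₀ ∫ ‖Y‖²` pays for the residual; the other half stays on the left.
  have key : ∀ s ∈ Icc 0 T, S.ρ₀ * ‖S.K (Y s)‖ ^ 2 + S.κ₀ * ∫ t in (0 : ℝ)..s, ‖Y t‖ ^ 2 ≤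
      a + ∫ t in (0 : ℝ)..s, ‖S.K (Y t)‖ ^ 2 := by
    intro s hs
    have e := h.energy_le hs.1
    have c₁ := S.P_coercive (S.K (Y s))
    have c₂ := S.R_coercive (Z s)
    have c₃ := hb s hs
    have c₄ := integral_norm_sq_mono (memLp_two_of_continuousOn hF.continuousOn) hs
    have c₅ : 0 ≤ S.r₀ * ‖Z s‖ ^ 2 := mul_nonneg S.r₀_pos.le (by positivity)
    simp only [a]
    linarith
  have hnn : ∀ s ∈ Icc 0 T, 0 ≤ S.κ₀ * ∫ t in (0 : ℝ)..s, ‖Y t‖ ^ 2 := fun s hs =>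
    mul_nonneg S.κ₀_pos.le (intervalIntegral.integral_nonneg hs.1 fun _ _ => by positivity)
  have gron := gronwall_integral (a := a) (T := T) hρ hcm.continuousOn fun s hs => by
    linarith [key s hs, hnn s hs]
  have ha : 0 ≤ a := by
    have := key 0 ⟨le_rfl, hT⟩
    simp only [intervalIntegral.integral_same, mul_zero, add_zero] at this
    exact (by positivity : 0 ≤ S.ρ₀ * ‖S.K (Y 0)‖ ^ 2).trans this
  have hexp : ∀ s ∈ Icc 0 T, a * Real.exp (s / S.ρ₀) ≤ a * Real.exp (T / S.ρ₀) := fun s hs => by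
    gcongr; exact hs.2
  refine ⟨fun s hs => ?_, ?_⟩
  · linarith [key s hs, hnn s hs, gron s hs, hexp s hs]
  · have hs : T ∈ Icc 0 T := ⟨hT, le_rfl⟩
    linarith [key T hs, gron T hs, mul_nonneg hρ.le (sq_nonneg ‖S.K (Y T)‖)]

/-- Young's inequality `2 (g, Y) ≤ ‖g‖² / κ₀ + κ₀ ‖Y‖²`. The residual acts on `Y` itself rather than
on `K Y`, so only the strong damping can absorb it. -/
theorem stability_residual (h : S.IsFlow F g Z Y Y') (hT : 0 ≤ T) :
    (∀ s ∈ Icc 0 T, S.ρ₀ * ‖S.K (Y s)‖ ^ 2 ≤ (inner ℝ (S.P (S.K (Y 0))) (S.K (Y 0))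
      + (∫ t in (0 : ℝ)..T, ‖F t‖ ^ 2) + (∫ t in (0 : ℝ)..T, ‖g t‖ ^ 2) / S.κ₀)
      * Real.exp (T / S.ρ₀)) ∧
    S.κ₀ * ∫ t in (0 : ℝ)..T, ‖Y t‖ ^ 2 ≤ (inner ℝ (S.P (S.K (Y 0))) (S.K (Y 0))
      + (∫ t in (0 : ℝ)..T, ‖F t‖ ^ 2) + (∫ t in (0 : ℝ)..T, ‖g t‖ ^ 2) / S.κ₀)
      * Real.exp (T / S.ρ₀) := by
  refine h.stability hT fun s hs => ?_
  have hY := h.cont_Y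
  have hg := h.cont_g
  have hκ := S.κ₀_pos
  have hm := integral_norm_sq_mono (memLp_two_of_continuousOn (T := T) hg.continuousOn) hs
  have c₀ : Continuous fun t => 2 * (inner ℝ (g t) (Y t) : ℝ) := by fun_prop
  have c₁ : Continuous fun t => ‖g t‖ ^ 2 / S.κ₀ := by fun_prop
  have c₂ : Continuous fun t => S.κ₀ * ‖Y t‖ ^ 2 := by fun_prop
  rw [← intervalIntegral.integral_const_mul, ← intervalIntegral.integral_const_mul]
  calc _ ≤ ∫ t in (0 : ℝ)..s, (‖g t‖ ^ 2 / S.κ₀ + S.κ₀ * ‖Y t‖ ^ 2) := by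
        refine intervalIntegral.integral_mono_on hs.1 (c₀.intervalIntegrable _ _)
          ((c₁.add c₂).intervalIntegrable _ _) fun t _ => ?_
        have e := real_inner_le_norm (g t) (Y t)
        have : ‖g t‖ ^ 2 / S.κ₀ + S.κ₀ * ‖Y t‖ ^ 2 - 2 * (‖g t‖ * ‖Y t‖) =
          (‖g t‖ - S.κ₀ * ‖Y t‖) ^ 2 / S.κ₀ := by field_simp; ring
        have : 0 ≤ (‖g t‖ - S.κ₀ * ‖Y t‖) ^ 2 / S.κ₀ := by positivity
        linarith
    _ ≤ _ := by
        rw [intervalIntegral.integral_add (c₁.intervalIntegrable _ _) (c₂.intervalIntegrable _ _),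
          intervalIntegral.integral_div]
        gcongr

/-- The second energy estimate, obtained by testing the regularised equation with `Y'`. -/
theorem acceleration_le [CompleteSpace X] {ε : ℝ}
    (h : S.IsFlow F (fun s => -(ε • Y' s)) Z Y Y') (hT : 0 ≤ T) :
    (ε * ∫ t in (0 : ℝ)..T, ‖Y' t‖ ^ 2) + S.ρ₀ / 2 * ∫ t in (0 : ℝ)..T, ‖S.K (Y' t)‖ ^ 2 ≤
    1 / S.ρ₀ * (∫ t in (0 : ℝ)..T, ‖F t‖ ^ 2) + (‖S.Q‖ ^ 2 * ‖S.K‖ ^ 2 / S.ρ₀ + ‖S.R‖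
      + ‖S.R‖ ^ 2 * T / (2 * S.κ₀)) * (∫ t in (0 : ℝ)..T, ‖Y t‖ ^ 2)
      + ‖S.C‖ / 2 * ‖Y 0‖ ^ 2 := by
  have hZ := h.cont_Z
  have hY := h.cont_Y
  have hF := h.cont_F
  have hY' := h.cont_Y'
  have hρ := S.ρ₀_pos
  have hκ := S.κ₀_pos
  -- With the test function `Y'`, the stiffness term is integrated by parts in time, `(R Z, Y') = (R
  -- Z, Y)' - (R Y, Y)`, and the damping term is the derivative of `(C Y, Y) / 2`.
  have hd : ∀ t, HasDerivAt
      (fun t => inner ℝ (S.R (Z t)) (Y t) + inner ℝ (S.C (Y t)) (Y t) / 2)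
      (inner ℝ (S.R (Y t)) (Y t) + inner ℝ (S.R (Z t)) (Y' t) + inner ℝ (S.C (Y t)) (Y' t)) t := by
    intro t
    have dRZ : HasDerivAt (fun t => S.R (Z t)) (S.R (Y t)) t :=
      S.R.hasFDerivAt.comp_hasDerivAt t (h.deriv_Z t)
    have dCY : HasDerivAt (fun t => S.C (Y t)) (S.C (Y' t)) t :=
      S.C.hasFDerivAt.comp_hasDerivAt t (h.deriv_Y t)
    have := (dRZ.inner ℝ (h.deriv_Y t)).add ((dCY.inner ℝ (h.deriv_Y t)).div_const 2)
    refine this.congr_deriv ?_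
    rw [S.C_symm (Y' t), real_inner_comm (S.C (Y t)) (Y' t)]
    ring
  have hcd : Continuous fun t => (inner ℝ (S.R (Y t)) (Y t) + inner ℝ (S.R (Z t)) (Y' t)
    + inner ℝ (S.C (Y t)) (Y' t) : ℝ) := by fun_prop
  have hftc := intervalIntegral.integral_eq_sub_of_hasDerivAt (fun t _ => hd t)
    (hcd.intervalIntegrable 0 T)
  have j : ∀ {f : ℝ → ℝ}, Continuous f → IntervalIntegrable f volume 0 T :=
    fun hf => hf.intervalIntegrable _ _
  have i₁ := j (by fun_prop : Continuous fun t => ‖F t‖ ^ 2)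
  have i₂ := j (by fun_prop : Continuous fun t => ‖Y t‖ ^ 2)
  have i₃ := j (by fun_prop : Continuous fun t => ‖Y' t‖ ^ 2)
  have i₄ := j (by fun_prop : Continuous fun t => ‖S.K (Y' t)‖ ^ 2)
  have hmono : ∫ t in (0 : ℝ)..T, (ε * ‖Y' t‖ ^ 2 + S.ρ₀ / 2 * ‖S.K (Y' t)‖ ^ 2) ≤
      ∫ t in (0 : ℝ)..T, (1 / S.ρ₀ * ‖F t‖ ^ 2 + (‖S.Q‖ ^ 2 * ‖S.K‖ ^ 2 / S.ρ₀ + ‖S.R‖) * ‖Y t‖ ^ 2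
        - (inner ℝ (S.R (Y t)) (Y t) + inner ℝ (S.R (Z t)) (Y' t)
          + inner ℝ (S.C (Y t)) (Y' t))) := by
    refine intervalIntegral.integral_mono_on hT ((i₃.const_mul _).add (i₄.const_mul _))
      (((i₁.const_mul _).add (i₂.const_mul _)).sub (j hcd)) fun t _ => ?_
    have e := h.eqn t (Y' t)
    simp only [inner_neg_left, real_inner_smul_left, real_inner_self_eq_norm_sq] at e
    have c₁ := S.P_coercive (S.K (Y' t))
    have c₂ := real_inner_le_norm (F t) (S.K (Y' t))
    have c₃ := neg_le_of_abs_le (abs_real_inner_le_norm (S.Q (S.K (Y t))) (S.K (Y' t)))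
    have c₄ := real_inner_le_norm (S.R (Y t)) (Y t)
    have c₅ : ‖S.R (Y t)‖ * ‖Y t‖ ≤ ‖S.R‖ * ‖Y t‖ ^ 2 := by
      rw [sq, ← mul_assoc]; gcongr; exact S.R.le_opNorm _
    have c₆ : ‖S.Q (S.K (Y t))‖ ^ 2 ≤ ‖S.Q‖ ^ 2 * ‖S.K‖ ^ 2 * ‖Y t‖ ^ 2 := by
      rw [← mul_pow, ← mul_pow, mul_assoc]
      gcongr
      exact (S.Q.le_opNorm _).trans (by gcongr; exact S.K.le_opNorm _)
    -- Used for the load and for the `Q` term: each costs `ρ₀ / 4`, so `ρ₀ / 2` of the coercivity of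
    -- `P` remains.
    have c₇ : ∀ a : ℝ, a * ‖S.K (Y' t)‖ ≤ 1 / S.ρ₀ * a ^ 2 + S.ρ₀ / 4 * ‖S.K (Y' t)‖ ^ 2 :=
      fun a => by
        have : 1 / S.ρ₀ * a ^ 2 + S.ρ₀ / 4 * ‖S.K (Y' t)‖ ^ 2 - a * ‖S.K (Y' t)‖ =
          (a - S.ρ₀ / 2 * ‖S.K (Y' t)‖) ^ 2 / S.ρ₀ := by field_simp; ring
        have : 0 ≤ (a - S.ρ₀ / 2 * ‖S.K (Y' t)‖) ^ 2 / S.ρ₀ := by positivity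
        linarith
    have c₈ := c₇ ‖F t‖
    have c₉ := c₇ ‖S.Q (S.K (Y t))‖
    have c₁₀ : 1 / S.ρ₀ * ‖S.Q (S.K (Y t))‖ ^ 2 ≤
        ‖S.Q‖ ^ 2 * ‖S.K‖ ^ 2 / S.ρ₀ * ‖Y t‖ ^ 2 := by
      calc _ ≤ 1 / S.ρ₀ * (‖S.Q‖ ^ 2 * ‖S.K‖ ^ 2 * ‖Y t‖ ^ 2) := by gcongr
        _ = _ := by ring
    linarith
  rw [intervalIntegral.integral_sub ((i₁.const_mul _).add (i₂.const_mul _)) (j hcd),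
    intervalIntegral.integral_add (i₁.const_mul _) (i₂.const_mul _),
    intervalIntegral.integral_add (i₃.const_mul _) (i₄.const_mul _)] at hmono
  simp only [intervalIntegral.integral_const_mul] at hmono
  rw [hftc, h.zero] at hmono
  simp only [map_zero, inner_zero_left, zero_add] at hmono
  have d₁ : ‖Z T‖ ^ 2 ≤ T * ∫ t in (0 : ℝ)..T, ‖Y t‖ ^ 2 := by
    rw [h.Z_eq_integral T]
    exact sq_norm_integral_le (memLp_two_of_continuousOn hY.continuousOn) ⟨hT, le_rfl⟩
  have d₂ : inner ℝ (S.C (Y 0)) (Y 0) ≤ ‖S.C‖ * ‖Y 0‖ ^ 2 := by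
    refine (real_inner_le_norm _ _).trans ?_
    rw [sq, ← mul_assoc]; gcongr; exact S.C.le_opNorm _
  have d₃ := S.C_coercive (Y T)
  have d₄ : -(inner ℝ (S.R (Z T)) (Y T) : ℝ) ≤ ‖S.R‖ * ‖Z T‖ * ‖Y T‖ := by
    refine (neg_le_abs _).trans ((abs_real_inner_le_norm _ _).trans ?_)
    gcongr; exact S.R.le_opNorm _
  -- The end-point term left by the integration by parts is absorbed by `(C Y, Y) / 2 ≥ κ₀ / 2 *
  -- ‖Y‖²` at time `T`.
  have d₅ : ‖S.R‖ * ‖Z T‖ * ‖Y T‖ ≤ ‖S.R‖ ^ 2 * ‖Z T‖ ^ 2 / (2 * S.κ₀) + S.κ₀ / 2 * ‖Y T‖ ^ 2 := by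
    have : ‖S.R‖ ^ 2 * ‖Z T‖ ^ 2 / (2 * S.κ₀) + S.κ₀ / 2 * ‖Y T‖ ^ 2 - ‖S.R‖ * ‖Z T‖ * ‖Y T‖ =
      (‖S.R‖ * ‖Z T‖ - S.κ₀ * ‖Y T‖) ^ 2 / (2 * S.κ₀) := by field_simp; ring
    have : 0 ≤ (‖S.R‖ * ‖Z T‖ - S.κ₀ * ‖Y T‖) ^ 2 / (2 * S.κ₀) := by positivity
    linarith
  have d₆ : ‖S.R‖ ^ 2 * ‖Z T‖ ^ 2 / (2 * S.κ₀) ≤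
      ‖S.R‖ ^ 2 * T / (2 * S.κ₀) * ∫ t in (0 : ℝ)..T, ‖Y t‖ ^ 2 := by
    calc _ ≤ ‖S.R‖ ^ 2 * (T * ∫ t in (0 : ℝ)..T, ‖Y t‖ ^ 2) / (2 * S.κ₀) := by gcongr
      _ = _ := by ring
  linarith

end IsFlow

/-! ### Solvability of the regularised equation -/

/-- Classical solvability of the regularised equation. -/
theorem exists_regularized [CompleteSpace X] [CompleteSpace H] (S : DampedSystem X H) {ε : ℝ}
    (hε : 0 < ε) (hF : Continuous F) (ζ : X) :
    ∃ Z Y Y' : ℝ → X, S.IsFlow F (fun s => -(ε • Y' s)) Z Y Y' ∧ Y 0 = ζ := by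
  let K' : H →L[ℝ] X := ContinuousLinearMap.adjoint S.K
  -- The summand `ε` makes `ε + K* P K` coercive, hence invertible by Lax–Milgram. Solving for `Y'`
  -- then turns the equation into a first-order system on `X × X` with bounded generator `L`.
  let A : X →L[ℝ] X := ε • ContinuousLinearMap.id ℝ X + K' ∘L S.P ∘L S.K
  have hA : ∀ v w, inner ℝ (A v) w = ε * inner ℝ v w + inner ℝ (S.P (S.K v)) (S.K w) := by
    intro v w
    simp [A, K', inner_add_left, real_inner_smul_left, ContinuousLinearMap.adjoint_inner_left]
  let B : X →L[ℝ] X →L[ℝ] ℝ := (innerSL ℝ : X →L[ℝ] X →L[ℝ] ℝ) ∘L A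
  have hB : ∀ v w, B v w = inner ℝ (A v) w := fun v w => rfl
  have hco : IsCoercive B := ⟨ε, hε, fun v => by
    rw [hB, hA, real_inner_self_eq_norm_sq]
    have := S.P_coercive (S.K v)
    have := mul_nonneg S.ρ₀_pos.le (sq_nonneg ‖S.K v‖)
    nlinarith⟩
  let e := hco.continuousLinearEquivOfBilin
  have he : ∀ v w, inner ℝ (e v) w = inner ℝ (A v) w := fun v w =>
    hco.continuousLinearEquivOfBilin_apply v w
  let D : X × X →L[ℝ] X := K' ∘L S.Q ∘L S.K ∘L ContinuousLinearMap.snd ℝ X X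
    + S.R ∘L ContinuousLinearMap.fst ℝ X X + S.C ∘L ContinuousLinearMap.snd ℝ X X
  let L : X × X →L[ℝ] X × X :=
    (ContinuousLinearMap.snd ℝ X X).prod (-((e.symm : X →L[ℝ] X) ∘L D))
  have hf : Continuous fun s => ((0 : X), e.symm (K' (F s))) := by fun_prop
  obtain ⟨u, hu0, hu⟩ := exists_linear_ode L hf (0, ζ)
  have h1 : ∀ s, HasDerivAt (fun s => (u s).1) (u s).2 s := fun s => by
    have := (ContinuousLinearMap.fst ℝ X X).hasFDerivAt.comp_hasDerivAt s (hu s)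
    exact this.congr_deriv (by simp [L])
  have h2 : ∀ s, HasDerivAt (fun s => (u s).2) (e.symm (K' (F s) - D (u s))) s := fun s => by
    have := (ContinuousLinearMap.snd ℝ X X).hasFDerivAt.comp_hasDerivAt s (hu s)
    refine this.congr_deriv ?_
    simp [L, sub_eq_neg_add]
  have huc : Continuous u := continuous_iff_continuousAt.2 fun s => (hu s).continuousAt
  have hc : Continuous fun s => e.symm (K' (F s) - D (u s)) := by fun_prop
  refine ⟨_, _, _, ⟨h1, h2, hc, hF, (hc.const_smul ε).neg, by simp [hu0], fun s ζ => ?_⟩,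
    by simp [hu0]⟩
  have e1 := he (e.symm (K' (F s) - D (u s))) ζ
  rw [ContinuousLinearEquiv.apply_symm_apply, hA, inner_sub_left] at e1
  simp only [D, K', add_apply, ContinuousLinearMap.comp_apply,
    ContinuousLinearMap.coe_snd', ContinuousLinearMap.coe_fst', inner_add_left,
    ContinuousLinearMap.adjoint_inner_left] at e1
  simp only [inner_neg_left, real_inner_smul_left]
  simp only [D, K', add_apply, ContinuousLinearMap.comp_apply,
    ContinuousLinearMap.coe_snd', ContinuousLinearMap.coe_fst']
  linarith

end DampedSystem

/-! ### Cauchy sequences, density and weak derivatives in time -/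

section Limits

variable {E : Type*} [NormedAddCommGroup E] [InnerProductSpace ℝ E] {T : ℝ}

theorem exists_forall_add_le {a : ℕ → ℝ} (ha : Tendsto a atTop (𝓝 0)) {ε : ℝ} (hε : 0 < ε) :
    ∃ N, ∀ m ≥ N, ∀ n ≥ N, a m + a n ≤ ε := by
  obtain ⟨N, hN⟩ := eventually_atTop.1 (ha.eventually (Iic_mem_nhds (half_pos hε)))
  exact ⟨N, fun m hm n hn => by
    have h₁ : a m ≤ ε / 2 := hN m hm
    have h₂ : a n ≤ ε / 2 := hN n hn
    linarith⟩

theorem integral_norm_sub_sq_le {f g : ℝ → E} (hT : 0 ≤ T)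
    (hf : MemLp f 2 (volume.restrict (Ioo 0 T))) (hg : MemLp g 2 (volume.restrict (Ioo 0 T))) :
    ∫ t in (0 : ℝ)..T, ‖f t - g t‖ ^ 2 ≤
      2 * (∫ t in (0 : ℝ)..T, ‖f t‖ ^ 2) + 2 * ∫ t in (0 : ℝ)..T, ‖g t‖ ^ 2 := by
  have hs : T ∈ Icc 0 T := ⟨hT, le_rfl⟩
  rw [← intervalIntegral.integral_const_mul, ← intervalIntegral.integral_const_mul,
    ← intervalIntegral.integral_add ((MemLp.intervalIntegrable_norm_sq hf hs).const_mul _)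
      ((MemLp.intervalIntegrable_norm_sq hg hs).const_mul _)]
  refine intervalIntegral.integral_mono_on hT
    (MemLp.intervalIntegrable_norm_sq (hf.sub hg) hs)
    (((MemLp.intervalIntegrable_norm_sq hf hs).const_mul _).add
      ((MemLp.intervalIntegrable_norm_sq hg hs).const_mul _)) fun t _ => ?_
  nlinarith [parallelogram_law_with_norm ℝ (f t) (g t), sq_nonneg ‖f t + g t‖]

/-- Uniform limits of uniform Cauchy sequences of continuous functions on `[0,T]`. -/
theorem exists_uniform_limit [CompleteSpace E] {f : ℕ → ℝ → E} {a : ℕ → ℝ}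
    (hf : ∀ n, Continuous (f n)) (ha : Tendsto a atTop (𝓝 0))
    (h : ∀ m n, ∀ s ∈ Icc 0 T, ‖f m s - f n s‖ ^ 2 ≤ a m + a n) :
    ∃ U : ℝ → E, ContinuousOn U (Icc 0 T) ∧ ∀ n, ∀ s ∈ Icc 0 T, ‖f n s - U s‖ ^ 2 ≤ a n := by
  have hc : ∀ s ∈ Icc 0 T, CauchySeq fun n => f n s := fun s hs => by
    rw [Metric.cauchySeq_iff]
    intro ε hε
    obtain ⟨N, hN⟩ := exists_forall_add_le ha (ε := (ε / 2) ^ 2) (by positivity)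
    refine ⟨N, fun m hm n hn => ?_⟩
    have := abs_le_of_sq_le_sq ((h m n s hs).trans (hN m hm n hn)) (by positivity)
    rw [abs_of_nonneg (norm_nonneg _)] at this
    rw [dist_eq_norm]; linarith
  have hl : ∀ s, ∃ u, s ∈ Icc 0 T → Tendsto (fun n => f n s) atTop (𝓝 u) := fun s => by
    by_cases hs : s ∈ Icc 0 T
    · obtain ⟨u, hu⟩ := cauchySeq_tendsto_of_complete (hc s hs)
      exact ⟨u, fun _ => hu⟩
    · exact ⟨0, fun h => absurd h hs⟩
  choose U hU using hl
  have hb : ∀ n, ∀ s ∈ Icc 0 T, ‖f n s - U s‖ ^ 2 ≤ a n := fun n s hs => by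
    have h1 : Tendsto (fun m => ‖f n s - f m s‖ ^ 2) atTop (𝓝 (‖f n s - U s‖ ^ 2)) :=
      ((tendsto_const_nhds.sub (hU s hs)).norm).pow 2
    have h2 : Tendsto (fun m => a n + a m) atTop (𝓝 (a n)) := by
      simpa using tendsto_const_nhds.add ha
    exact le_of_tendsto_of_tendsto' h1 h2 fun m => h n m s hs
  refine ⟨U, ?_, hb⟩
  refine TendstoUniformlyOn.continuousOn (F := f) (p := atTop) ?_
    (Frequently.of_forall fun n => (hf n).continuousOn)
  rw [Metric.tendstoUniformlyOn_iff]
  intro ε hε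
  filter_upwards [ha.eventually (Iio_mem_nhds (show 0 < (ε / 2) ^ 2 by positivity))] with n hn s hs
  have := abs_le_of_sq_le_sq ((hb n s hs).trans hn.le) (by positivity)
  rw [abs_of_nonneg (norm_nonneg _)] at this
  rw [dist_comm, dist_eq_norm]; linarith

theorem tendsto_L2_of_pointwise_bound (hT : 0 ≤ T) {f : ℕ → ℝ → E} {u : ℝ → E} {a : ℕ → ℝ}
    (ha : Tendsto a atTop (𝓝 0)) (hf : ∀ n, ContinuousOn (f n) (Icc 0 T))
    (hu : ContinuousOn u (Icc 0 T)) (h : ∀ n, ∀ s ∈ Icc 0 T, ‖f n s - u s‖ ^ 2 ≤ a n) :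
    Tendsto (fun n => ∫ t in (0 : ℝ)..T, ‖f n t - u t‖ ^ 2) atTop (𝓝 0) := by
  have h1 : Tendsto (fun n => T * a n) atTop (𝓝 0) := by simpa using ha.const_mul T
  refine squeeze_zero (fun n => intervalIntegral.integral_nonneg hT fun _ _ => by positivity)
    (fun n => ?_) h1
  calc _ ≤ ∫ t in (0 : ℝ)..T, a n := intervalIntegral.integral_mono_on hT
        (MemLp.intervalIntegrable_norm_sq
          ((memLp_two_of_continuousOn (hf n)).sub (memLp_two_of_continuousOn hu))
          ⟨hT, le_rfl⟩) intervalIntegrable_const (h n)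
    _ = T * a n := by simp

theorem tendsto_integral_clm_of_L2 [CompleteSpace E] {Y : ℕ → ℝ → E} {y : ℝ → E}
    (hY : ∀ n, MemLp (Y n) 2 (volume.restrict (Ioo 0 T)))
    (hy : MemLp y 2 (volume.restrict (Ioo 0 T)))
    (h : Tendsto (fun n => ∫ t in (0 : ℝ)..T, ‖Y n t - y t‖ ^ 2) atTop (𝓝 0))
    (A : E →L[ℝ] ℝ) {s : ℝ} (hs : s ∈ Icc 0 T) :
    Tendsto (fun n => ∫ t in (0 : ℝ)..s, A (Y n t)) atTop (𝓝 (∫ t in (0 : ℝ)..s, A (y t))) := by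
  rw [A.intervalIntegral_comp_comm (MemLp.intervalIntegrable_two hy hs)]
  refine ((A.continuous.tendsto _).comp (tendsto_integral_of_L2 hY hy h hs)).congr fun n => ?_
  exact (A.intervalIntegral_comp_comm (MemLp.intervalIntegrable_two (hY n) hs)).symm

/-- Continuous functions are dense in `L²(0,T;E)`. -/
theorem exists_continuous_L2_approx (hT : 0 ≤ T) {F : ℝ → E}
    (hF : MemLp F 2 (volume.restrict (Ioo 0 T))) :
    ∃ f : ℕ → ℝ → E, (∀ n, Continuous (f n)) ∧
      Tendsto (fun n => ∫ t in (0 : ℝ)..T, ‖f n t - F t‖ ^ 2) atTop (𝓝 0) := by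
  have h : ∀ n : ℕ, ∃ f : ℝ → E, Continuous f ∧
      ∫ t in (0 : ℝ)..T, ‖f t - F t‖ ^ 2 ≤ (1 / ((n : ℝ) + 1)) ^ 2 := fun n => by
    have hn : (0 : ℝ) < 1 / ((n : ℝ) + 1) := by positivity
    obtain ⟨f, hf, hfm⟩ := hF.exists_boundedContinuous_eLpNorm_sub_le (by norm_num)
      (ε := ENNReal.ofReal (1 / ((n : ℝ) + 1))) (by simpa using hn)
    refine ⟨f, f.continuous, ?_⟩
    have h1 := norm_toLp_sq_interval hT (hF.sub hfm)
    simp only [Pi.sub_apply] at h1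
    simp_rw [norm_sub_rev (f _)]
    rw [← h1]
    gcongr
    rw [Lp.norm_toLp]
    exact ENNReal.toReal_le_of_le_ofReal hn.le hf
  choose f hf hb using h
  refine ⟨f, hf, squeeze_zero
    (fun n => intervalIntegral.integral_nonneg hT fun _ _ => by positivity) hb ?_⟩
  simpa using (tendsto_one_div_add_atTop_nhds_zero_nat (𝕜 := ℝ)).pow 2

/-- Primitives of a bounded sequence in `L²(0,T;E)` converge pointwise only to a function with
square integrable derivative. -/
theorem exists_L2_derivative [CompleteSpace E] (hT : 0 ≤ T) {V : ℕ → ℝ → E} {W : ℝ → E} {B : ℝ}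
    (hV : ∀ n, MemLp (V n) 2 (volume.restrict (Ioo 0 T)))
    (hB : ∀ n, ∫ t in (0 : ℝ)..T, ‖V n t‖ ^ 2 ≤ B)
    (hW : ∀ s ∈ Icc 0 T, Tendsto (fun n => ∫ t in (0 : ℝ)..s, V n t) atTop (𝓝 (W s))) :
    ∃ v : ℝ → E, MemLp v 2 (volume.restrict (Ioo 0 T)) ∧
      ∀ s ∈ Icc 0 T, W s = ∫ t in (0 : ℝ)..s, v t := by
  obtain ⟨w, hw⟩ := exists_weak_limit (v := fun n => (hV n).toLp (V n)) (C := √B) fun n =>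
    Real.le_sqrt_of_sq_le (by rw [norm_toLp_sq_interval hT]; exact hB n)
  refine ⟨w, Lp.memLp w, fun s hs => ?_⟩
  have hres : ∀ f : ℝ → E, ∫ t in Ioo 0 s, f t ∂(volume.restrict (Ioo 0 T)) =
      ∫ t in (0 : ℝ)..s, f t := fun f => by
    rw [Measure.restrict_restrict measurableSet_Ioo,
      inter_eq_left.2 (Ioo_subset_Ioo_right hs.2), intervalIntegral.integral_of_le hs.1,
      integral_Ioc_eq_integral_Ioo]
  have hfin : (volume.restrict (Ioo 0 T)) (Ioo 0 s) ≠ ⊤ := measure_ne_top _ _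
  refine ext_inner_right ℝ fun c => ?_
  -- Pairing the weak limit with `c` times the indicator of `(0,s)` evaluates its primitive at `s`
  -- in the direction `c`.
  have h1 := hw (indicatorConstLp 2 measurableSet_Ioo hfin c)
  have h2 : ∀ f : Lp E 2 (volume.restrict (Ioo 0 T)),
      inner ℝ f (indicatorConstLp 2 measurableSet_Ioo hfin c) =
        inner ℝ (∫ t in (0 : ℝ)..s, f t) c := fun f => by
    rw [real_inner_comm, L2.inner_indicatorConstLp_eq_inner_setIntegral, hres, real_inner_comm]
  simp only [h2] at h1
  have h3 : ∀ n, ∫ t in (0 : ℝ)..s, (hV n).toLp (V n) t = ∫ t in (0 : ℝ)..s, V n t := fun n => by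
    rw [← hres, ← hres]
    exact integral_congr_ae (ae_restrict_of_ae (hV n).coeFn_toLp)
  simp only [h3] at h1
  have h4 : Tendsto (fun n => (inner ℝ (∫ t in (0 : ℝ)..s, V n t) c : ℝ)) (hyperfilter ℕ)
      (𝓝 (inner ℝ (W s) c)) :=
    ((hW s hs).mono_left Nat.hyperfilter_le_atTop).inner tendsto_const_nhds
  exact tendsto_nhds_unique h4 h1

end Limits

/-! ### Vanishing regularisation -/

namespace DampedSystem

variable {X H : Type*} [NormedAddCommGroup X] [InnerProductSpace ℝ X] [CompleteSpace X]
  [NormedAddCommGroup H] [InnerProductSpace ℝ H] [CompleteSpace H]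
  {S : DampedSystem X H} {T : ℝ}

/-- The regularising term is itself an energy: `2 (-ε Y', Y)` is the derivative of `-ε ‖Y‖²`, so it
costs only `ε ‖Y 0‖²`. Unlike `stability_residual`, this needs no prior control of `Y'`. -/
theorem IsFlow.stability_regularized {F : ℝ → H} {Z Y Y' : ℝ → X} {ε : ℝ} (hε : 0 < ε)
    (hT : 0 ≤ T) (h : S.IsFlow F (fun s => -(ε • Y' s)) Z Y Y') :
    S.κ₀ * ∫ t in (0 : ℝ)..T, ‖Y t‖ ^ 2 ≤ (‖S.P‖ * ‖S.K‖ ^ 2 * ‖Y 0‖ ^ 2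
      + (∫ t in (0 : ℝ)..T, ‖F t‖ ^ 2) + ε * ‖Y 0‖ ^ 2) * Real.exp (T / S.ρ₀) := by
  have hY := h.cont_Y
  have hY' := h.cont_Y'
  refine (h.stability hT (b := ε * ‖Y 0‖ ^ 2) fun s hs => ?_).2.trans ?_
  · have hd : ∀ t, HasDerivAt (fun t => -(ε / 2 * ‖Y t‖ ^ 2)) (inner ℝ (-(ε • Y' t)) (Y t)) t :=
      fun t => by
        refine (((h.deriv_Y t).norm_sq.const_mul (ε / 2)).neg).congr_deriv ?_
        rw [inner_neg_left, real_inner_smul_left, real_inner_comm]; ring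
    have hc : Continuous fun t => (inner ℝ (-(ε • Y' t)) (Y t) : ℝ) := by fun_prop
    rw [intervalIntegral.integral_eq_sub_of_hasDerivAt (fun t _ => hd t)
      (hc.intervalIntegrable 0 s)]
    have h1 : 0 ≤ S.κ₀ * ∫ t in (0 : ℝ)..s, ‖Y t‖ ^ 2 := mul_nonneg S.κ₀_pos.le
      (intervalIntegral.integral_nonneg hs.1 fun _ _ => by positivity)
    have h2 : 0 ≤ ε * ‖Y s‖ ^ 2 := by positivity
    linarith
  · gcongr
    calc _ ≤ ‖S.P (S.K (Y 0))‖ * ‖S.K (Y 0)‖ := real_inner_le_norm _ _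
      _ ≤ ‖S.P‖ * (‖S.K‖ * ‖Y 0‖) * (‖S.K‖ * ‖Y 0‖) := by
          gcongr
          · exact (S.P.le_opNorm _).trans (by gcongr; exact S.K.le_opNorm _)
          · exact S.K.le_opNorm _
      _ = _ := by ring

/-- Classical flows with vanishing residuals and converging loads. -/
theorem exists_approximation (S : DampedSystem X H) (hT : 0 ≤ T) {F : ℝ → H}
    (hF : MemLp F 2 (volume.restrict (Ioo 0 T))) (ζ : ℕ → X) :
    ∃ (f : ℕ → ℝ → H) (g Z Y Y' : ℕ → ℝ → X),
      (∀ n, S.IsFlow (f n) (g n) (Z n) (Y n) (Y' n)) ∧ (∀ n, Y n 0 = ζ n) ∧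
      Tendsto (fun n => ∫ t in (0 : ℝ)..T, ‖f n t - F t‖ ^ 2) atTop (𝓝 0) ∧
      Tendsto (fun n => ∫ t in (0 : ℝ)..T, ‖g n t‖ ^ 2) atTop (𝓝 0) ∧
      ∃ M, 0 ≤ M ∧ ∀ n, ∫ t in (0 : ℝ)..T, ‖S.K (Y' n t)‖ ^ 2 ≤ M * (1 + ‖ζ n‖ ^ 2) := by
  obtain ⟨f, hf, hfF⟩ := exists_continuous_L2_approx hT hF
  have hρ := S.ρ₀_pos
  have hκ := S.κ₀_pos
  have hfm : ∀ n, MemLp (f n) 2 (volume.restrict (Ioo 0 T)) := fun n =>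
    memLp_two_of_continuousOn (hf n).continuousOn
  obtain ⟨B, hB⟩ := (tendsto_integral_norm_sq_of_L2 hfm hF hfF ⟨hT, le_rfl⟩).bddAbove_range
  have hB : ∀ n, ∫ t in (0 : ℝ)..T, ‖f n t‖ ^ 2 ≤ B := fun n => hB ⟨n, rfl⟩
  have hB0 : 0 ≤ B := (intervalIntegral.integral_nonneg hT fun _ _ => by positivity).trans (hB 0)
  -- The `ζ n` may be unbounded. The squared residual is `ε` times `ε ∫ ‖Y'‖²`, hence at most `ε M
  -- (1 + ‖ζ n‖²)`, and this choice makes it `M / (n + 1)`.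
  let ε : ℕ → ℝ := fun n => 1 / ((n : ℝ) + 1) / (1 + ‖ζ n‖ ^ 2)
  have hε : ∀ n, 0 < ε n := fun n => by positivity
  have hε1 : ∀ n, ε n ≤ 1 := fun n => by
    refine div_le_one_of_le₀ (le_trans (div_le_one_of_le₀ ?_ (by positivity)) ?_) (by positivity)
    · linarith [(Nat.cast_nonneg n : (0 : ℝ) ≤ n)]
    · linarith [sq_nonneg ‖ζ n‖]
  choose Z Y Y' hflow hζ using fun n => S.exists_regularized (hε n) (hf n) (ζ n)
  let c := ‖S.Q‖ ^ 2 * ‖S.K‖ ^ 2 / S.ρ₀ + ‖S.R‖ + ‖S.R‖ ^ 2 * T / (2 * S.κ₀)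
  let e := Real.exp (T / S.ρ₀)
  have hc : 0 ≤ c := by positivity
  have he : 0 < e := Real.exp_pos _
  let M := 1 / S.ρ₀ * B + c * ((‖S.P‖ * ‖S.K‖ ^ 2 + B + 1) * e / S.κ₀) + ‖S.C‖ / 2
  have hM : 0 ≤ M := by positivity
  have key : ∀ n, (ε n * ∫ t in (0 : ℝ)..T, ‖Y' n t‖ ^ 2)
      + S.ρ₀ / 2 * ∫ t in (0 : ℝ)..T, ‖S.K (Y' n t)‖ ^ 2 ≤ M * (1 + ‖ζ n‖ ^ 2) := fun n => by
    have a₁ := (hflow n).acceleration_le hT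
    have a₂ := (hflow n).stability_regularized (hε n) hT
    rw [hζ] at a₁ a₂
    set y := ∫ t in (0 : ℝ)..T, ‖Y n t‖ ^ 2
    set q := ‖ζ n‖ ^ 2
    have hq : 0 ≤ q := sq_nonneg _
    have a₃ : y ≤ (‖S.P‖ * ‖S.K‖ ^ 2 + B + 1) * e / S.κ₀ * (1 + q) := by
      rw [div_mul_eq_mul_div, le_div_iff₀ hκ, mul_comm y]
      refine a₂.trans ?_
      rw [mul_assoc _ e, mul_comm e, ← mul_assoc]
      gcongr
      have h1 := hB n
      have h2 : ε n * q ≤ 1 * q := by gcongr; exact hε1 n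
      have h3 : 0 ≤ ‖S.P‖ * ‖S.K‖ ^ 2 := by positivity
      have h4 : 0 ≤ B * q := by positivity
      nlinarith
    have a₄ : c * y ≤ c * ((‖S.P‖ * ‖S.K‖ ^ 2 + B + 1) * e / S.κ₀ * (1 + q)) := by gcongr
    have a₅ : 1 / S.ρ₀ * (∫ t in (0 : ℝ)..T, ‖f n t‖ ^ 2) ≤ 1 / S.ρ₀ * B * (1 + q) := by
      calc _ ≤ 1 / S.ρ₀ * B * 1 := by rw [mul_one]; gcongr; exact hB n
        _ ≤ _ := by gcongr; linarith
    have a₆ : ‖S.C‖ / 2 * q ≤ ‖S.C‖ / 2 * (1 + q) := by gcongr; linarith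
    simp only [M]
    linarith
  have hn1 : ∀ n, 0 ≤ ∫ t in (0 : ℝ)..T, ‖Y' n t‖ ^ 2 := fun n =>
    intervalIntegral.integral_nonneg hT fun _ _ => by positivity
  have hn2 : ∀ n, 0 ≤ ∫ t in (0 : ℝ)..T, ‖S.K (Y' n t)‖ ^ 2 := fun n =>
    intervalIntegral.integral_nonneg hT fun _ _ => by positivity
  refine ⟨f, _, Z, Y, Y', hflow, hζ, hfF, ?_, 2 / S.ρ₀ * M, by positivity, fun n => ?_⟩
  · have hl : Tendsto (fun n : ℕ => M * (1 / ((n : ℝ) + 1))) atTop (𝓝 0) := by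
      simpa using (tendsto_one_div_add_atTop_nhds_zero_nat (𝕜 := ℝ)).const_mul M
    refine squeeze_zero (fun n => intervalIntegral.integral_nonneg hT fun _ _ => by positivity)
      (fun n => ?_) hl
    have h1 : ∫ t in (0 : ℝ)..T, ‖-(ε n • Y' n t)‖ ^ 2 =
        ε n * (ε n * ∫ t in (0 : ℝ)..T, ‖Y' n t‖ ^ 2) := by
      rw [← intervalIntegral.integral_const_mul, ← intervalIntegral.integral_const_mul]
      congr 1; ext t
      rw [norm_neg, norm_smul, Real.norm_of_nonneg (hε n).le]; ring
    rw [h1]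
    calc _ ≤ ε n * (M * (1 + ‖ζ n‖ ^ 2)) := by
          refine mul_le_mul_of_nonneg_left ?_ (hε n).le
          linarith [key n, mul_nonneg (half_pos hρ).le (hn2 n)]
      _ = _ := by
          have : 1 + ‖ζ n‖ ^ 2 ≠ 0 := by positivity
          simp only [ε]; field_simp
  · have h1 := key n
    have h2 := mul_nonneg (hε n).le (hn1 n)
    rw [mul_assoc, div_mul_eq_mul_div, le_div_iff₀ hρ]
    linarith

end DampedSystem

/-! ### Weak solutions of the abstract equation -/

namespace DampedSystem

variable {X H : Type*} [NormedAddCommGroup X] [InnerProductSpace ℝ X]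
  [NormedAddCommGroup H] [InnerProductSpace ℝ H]

/-- Integrating the equation in time removes `Y'`, the one quantity without a limit in general. -/
theorem IsFlow.weak_eq {S : DampedSystem X H} {f : ℝ → H} {g Z Y Y' : ℝ → X}
    (h : S.IsFlow f g Z Y Y') (ξ : X) (s : ℝ) :
    inner ℝ (S.P (S.K (Y s))) (S.K ξ) = inner ℝ (S.P (S.K (Y 0))) (S.K ξ)
      + ((∫ t in (0 : ℝ)..s, inner ℝ (f t) (S.K ξ)) + (∫ t in (0 : ℝ)..s, inner ℝ (g t) ξ)
        - (∫ t in (0 : ℝ)..s, inner ℝ (S.Q (S.K (Y t))) (S.K ξ))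
        - (∫ t in (0 : ℝ)..s, inner ℝ (S.R (Z t)) ξ)
        - ∫ t in (0 : ℝ)..s, inner ℝ (S.C (Y t)) ξ) := by
  have hZ := h.cont_Z
  have hY := h.cont_Y
  have hf := h.cont_F
  have hg := h.cont_g
  have hY' := h.cont_Y'
  have j : ∀ {f : ℝ → ℝ}, Continuous f → IntervalIntegrable f volume 0 s :=
    fun hf => hf.intervalIntegrable _ _
  have hd : ∀ t, HasDerivAt (fun t => inner ℝ (S.P (S.K (Y t))) (S.K ξ))
      (inner ℝ (S.P (S.K (Y' t))) (S.K ξ)) t := fun t => by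
    have dKY : HasDerivAt (fun t => S.K (Y t)) (S.K (Y' t)) t :=
      S.K.hasFDerivAt.comp_hasDerivAt t (h.deriv_Y t)
    have dPKY : HasDerivAt (fun t => S.P (S.K (Y t))) (S.P (S.K (Y' t))) t :=
      S.P.hasFDerivAt.comp_hasDerivAt t dKY
    refine (dPKY.inner ℝ (hasDerivAt_const t (S.K ξ))).congr_deriv (by simp)
  have e := intervalIntegral.integral_eq_sub_of_hasDerivAt (fun t _ => hd t)
    (j (f := fun t => inner ℝ (S.P (S.K (Y' t))) (S.K ξ)) (by fun_prop))
  have i₁ : IntervalIntegrable (fun t => (inner ℝ (f t) (S.K ξ) : ℝ)) volume 0 s :=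
    j (by fun_prop)
  have i₂ : IntervalIntegrable (fun t => (inner ℝ (g t) ξ : ℝ)) volume 0 s := j (by fun_prop)
  have i₃ : IntervalIntegrable (fun t => (inner ℝ (S.Q (S.K (Y t))) (S.K ξ) : ℝ)) volume 0 s :=
    j (by fun_prop)
  have i₄ : IntervalIntegrable (fun t => (inner ℝ (S.R (Z t)) ξ : ℝ)) volume 0 s :=
    j (by fun_prop)
  have i₅ : IntervalIntegrable (fun t => (inner ℝ (S.C (Y t)) ξ : ℝ)) volume 0 s :=
    j (by fun_prop)
  rw [← intervalIntegral.integral_add i₁ i₂, ← intervalIntegral.integral_sub (i₁.add i₂) i₃,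
    ← intervalIntegral.integral_sub ((i₁.add i₂).sub i₃) i₄,
    ← intervalIntegral.integral_sub (((i₁.add i₂).sub i₃).sub i₄) i₅, ← sub_eq_iff_eq_add', ← e]
  exact intervalIntegral.integral_congr fun t _ => by linarith [h.eqn t ξ]

/-- `Y = Z'`, together with the continuous representative `U` of `K Y`, is a weak solution of
the abstract equation with load `F` and initial velocity `h₀`, satisfying the energy
inequality. -/
structure IsWeakFlow (S : DampedSystem X H) (T : ℝ) (F : ℝ → H) (h₀ : H) (Y : ℝ → X)
    (U : ℝ → H) : Prop where
  memLp : MemLp Y 2 (volume.restrict (Ioo 0 T))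
  continuousOn : ContinuousOn U (Icc 0 T)
  initial : U 0 = h₀
  K_primitive : ∀ s ∈ Icc 0 T, S.K (∫ t in (0 : ℝ)..s, Y t) = ∫ t in (0 : ℝ)..s, U t
  weak : ∀ s ∈ Icc 0 T, ∀ ξ, inner ℝ (S.P (U s)) (S.K ξ) = inner ℝ (S.P h₀) (S.K ξ)
      + ((∫ t in (0 : ℝ)..s, inner ℝ (F t) (S.K ξ))
        - (∫ t in (0 : ℝ)..s, inner ℝ (S.Q (U t)) (S.K ξ))
        - (∫ t in (0 : ℝ)..s, inner ℝ (S.R (∫ τ in (0 : ℝ)..t, Y τ)) ξ)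
        - ∫ t in (0 : ℝ)..s, inner ℝ (S.C (Y t)) ξ)
  energy : ∀ s ∈ Icc 0 T, inner ℝ (S.P (U s)) (U s)
      + inner ℝ (S.R (∫ τ in (0 : ℝ)..s, Y τ)) (∫ τ in (0 : ℝ)..s, Y τ)
      + 2 * S.κ₀ * ∫ t in (0 : ℝ)..s, ‖Y t‖ ^ 2 ≤
    inner ℝ (S.P h₀) h₀ + (∫ t in (0 : ℝ)..s, ‖F t‖ ^ 2) + ∫ t in (0 : ℝ)..s, ‖U t‖ ^ 2

variable {S : DampedSystem X H} {T : ℝ}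

/-- Inserting the limit data `h₀`, `F` and `0` between the two flows splits the data of their
difference into one contribution per flow, which is the form needed for a Cauchy criterion. -/
theorem IsFlow.difference_le {f₁ f₂ F : ℝ → H} {g₁ g₂ Z₁ Z₂ Y₁ Y₂ Y₁' Y₂' : ℝ → X} {h₀ : H}
    (h₁ : S.IsFlow f₁ g₁ Z₁ Y₁ Y₁') (h₂ : S.IsFlow f₂ g₂ Z₂ Y₂ Y₂') (hT : 0 ≤ T)
    (hF : MemLp F 2 (volume.restrict (Ioo 0 T))) :
    inner ℝ (S.P (S.K (Y₁ 0 - Y₂ 0))) (S.K (Y₁ 0 - Y₂ 0))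
      + (∫ t in (0 : ℝ)..T, ‖f₁ t - f₂ t‖ ^ 2) + (∫ t in (0 : ℝ)..T, ‖g₁ t - g₂ t‖ ^ 2) / S.κ₀ ≤
    2 * (‖S.P‖ * ‖S.K (Y₁ 0) - h₀‖ ^ 2 + (∫ t in (0 : ℝ)..T, ‖f₁ t - F t‖ ^ 2)
        + (∫ t in (0 : ℝ)..T, ‖g₁ t‖ ^ 2) / S.κ₀)
      + 2 * (‖S.P‖ * ‖S.K (Y₂ 0) - h₀‖ ^ 2 + (∫ t in (0 : ℝ)..T, ‖f₂ t - F t‖ ^ 2)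
        + (∫ t in (0 : ℝ)..T, ‖g₂ t‖ ^ 2) / S.κ₀) := by
  have hκ := S.κ₀_pos
  have b₁ : inner ℝ (S.P (S.K (Y₁ 0 - Y₂ 0))) (S.K (Y₁ 0 - Y₂ 0)) ≤
      2 * (‖S.P‖ * ‖S.K (Y₁ 0) - h₀‖ ^ 2) + 2 * (‖S.P‖ * ‖S.K (Y₂ 0) - h₀‖ ^ 2) := by
    have e : S.K (Y₁ 0 - Y₂ 0) = (S.K (Y₁ 0) - h₀) - (S.K (Y₂ 0) - h₀) := by
      rw [map_sub]; abel
    rw [e]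
    set a := S.K (Y₁ 0) - h₀
    set b := S.K (Y₂ 0) - h₀
    calc _ ≤ ‖S.P‖ * ‖a - b‖ * ‖a - b‖ :=
          (real_inner_le_norm _ _).trans (by gcongr; exact S.P.le_opNorm _)
      _ = ‖S.P‖ * ‖a - b‖ ^ 2 := by ring
      _ ≤ ‖S.P‖ * (2 * ‖a‖ ^ 2 + 2 * ‖b‖ ^ 2) := by
          gcongr
          nlinarith [parallelogram_law_with_norm ℝ a b, sq_nonneg ‖a + b‖]
      _ = _ := by ring
  have b₂ := integral_norm_sub_sq_le hT ((memLp_two_of_continuousOn h₁.cont_F.continuousOn).sub hF)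
    ((memLp_two_of_continuousOn h₂.cont_F.continuousOn).sub hF)
  simp only [Pi.sub_apply, sub_sub_sub_cancel_right] at b₂
  have b₃ := integral_norm_sub_sq_le hT (memLp_two_of_continuousOn h₁.cont_g.continuousOn)
    (memLp_two_of_continuousOn h₂.cont_g.continuousOn)
  have b₄ := div_le_div_of_nonneg_right b₃ hκ.le
  rw [add_div, mul_div_assoc, mul_div_assoc] at b₄
  linarith

namespace IsWeakFlow

variable {F : ℝ → H} {h₀ : H} {Y : ℝ → X} {U : ℝ → H} {c : ℝ}

/-- Gronwall bounds for a weak solution with data of size `c`. -/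
theorem bounds (h : S.IsWeakFlow T F h₀ Y U) (hT : 0 ≤ T)
    (hF : MemLp F 2 (volume.restrict (Ioo 0 T)))
    (hc : inner ℝ (S.P h₀) h₀ + ∫ t in (0 : ℝ)..T, ‖F t‖ ^ 2 ≤ c) :
    ∫ t in (0 : ℝ)..T, ‖U t‖ ^ 2 ≤ c * (Real.exp (T / S.ρ₀) - 1) ∧
    ∫ t in (0 : ℝ)..T, ‖∫ τ in (0 : ℝ)..t, Y τ‖ ^ 2 ≤ T * c / S.r₀ * Real.exp (T / S.ρ₀) ∧
    ∫ t in (0 : ℝ)..T, ‖Y t‖ ^ 2 ≤ c / (2 * S.κ₀) * Real.exp (T / S.ρ₀) := by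
  have hρ := S.ρ₀_pos
  have hκ := S.κ₀_pos
  have hr := S.r₀_pos
  have hTm : T ∈ Icc 0 T := ⟨hT, le_rfl⟩
  let Z : ℝ → X := fun s => ∫ τ in (0 : ℝ)..s, Y τ
  have hzc : ContinuousOn Z (Icc 0 T) := continuousOn_primitive h.memLp hT
  have hnn : ∀ s ∈ Icc 0 T, 0 ≤ 2 * S.κ₀ * ∫ t in (0 : ℝ)..s, ‖Y t‖ ^ 2 := fun s hs =>
    mul_nonneg (by positivity) (intervalIntegral.integral_nonneg hs.1 fun _ _ => by positivity)
  have key : ∀ s ∈ Icc 0 T, S.ρ₀ * ‖U s‖ ^ 2 + S.r₀ * ‖Z s‖ ^ 2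
      + 2 * S.κ₀ * ∫ t in (0 : ℝ)..s, ‖Y t‖ ^ 2 ≤ c + ∫ t in (0 : ℝ)..s, ‖U t‖ ^ 2 :=
    fun s hs => by
      linarith [h.energy s hs, S.P_coercive (U s), S.R_coercive (Z s), integral_norm_sq_mono hF hs]
  have gron := gronwall_integral (m := fun s => ‖U s‖ ^ 2) (a := c) (T := T) hρ (h.continuousOn.norm.pow 2) fun s hs => by
    have : 0 ≤ S.r₀ * ‖Z s‖ ^ 2 := by positivity
    linarith [key s hs, hnn s hs]
  have hc0 : 0 ≤ c := by
    have := key 0 ⟨le_rfl, hT⟩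
    simp only [intervalIntegral.integral_same, mul_zero, add_zero] at this
    exact (by positivity : 0 ≤ S.ρ₀ * ‖U 0‖ ^ 2 + S.r₀ * ‖Z 0‖ ^ 2).trans this
  refine ⟨gron T hTm, ?_, ?_⟩
  -- The bound on `Z` is pointwise in time; integrating it produces the factor `T`.
  · have hb : ∀ s ∈ Icc 0 T, ‖Z s‖ ^ 2 ≤ c / S.r₀ * Real.exp (T / S.ρ₀) := fun s hs => by
      rw [div_mul_eq_mul_div, le_div_iff₀ hr]
      have h1 : c * Real.exp (s / S.ρ₀) ≤ c * Real.exp (T / S.ρ₀) := by gcongr; exact hs.2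
      have h2 : 0 ≤ S.ρ₀ * ‖U s‖ ^ 2 := by positivity
      linarith [key s hs, hnn s hs, gron s hs]
    calc _ ≤ ∫ t in (0 : ℝ)..T, c / S.r₀ * Real.exp (T / S.ρ₀) :=
          intervalIntegral.integral_mono_on hT
            (MemLp.intervalIntegrable_norm_sq (memLp_two_of_continuousOn hzc) hTm)
            intervalIntegrable_const hb
      _ = _ := by rw [intervalIntegral.integral_const, smul_eq_mul]; ring
  · rw [div_mul_eq_mul_div, le_div_iff₀ (by positivity)]
    have h1 : 0 ≤ S.ρ₀ * ‖U T‖ ^ 2 + S.r₀ * ‖Z T‖ ^ 2 := by positivity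
    linarith [key T hTm, gron T hTm]

end IsWeakFlow

variable [CompleteSpace X] [CompleteSpace H]

/-- Existence of a weak solution of the abstract equation, for every load in `L²` and every
initial velocity in the closure of the range of `K`. If the initial velocity is the image of a
bounded sequence, the solution has an acceleration in `L²`. -/
theorem exists_weakFlow (S : DampedSystem X H) (hT : 0 ≤ T) {F : ℝ → H}
    (hF : MemLp F 2 (volume.restrict (Ioo 0 T))) {ζ : ℕ → X} {h₀ : H}
    (hζ : Tendsto (fun n => S.K (ζ n)) atTop (𝓝 h₀)) :
    ∃ Y U, S.IsWeakFlow T F h₀ Y U ∧ ((∃ B, ∀ n, ‖ζ n‖ ≤ B) → ∃ V : ℝ → H, IsH1 0 T U V) := by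
  obtain ⟨f, g, Z, Y, Y', hfl, hY0, hf, hg, M, hM, hMb⟩ := S.exists_approximation hT hF ζ
  have hρ := S.ρ₀_pos
  have hκ := S.κ₀_pos
  have hYc : ∀ n, Continuous (Y n) := fun n => (hfl n).cont_Y
  have hKYc : ∀ n, Continuous fun t => S.K (Y n t) := fun n => S.K.continuous.comp (hYc n)
  have hYm : ∀ n, MemLp (Y n) 2 (volume.restrict (Ioo 0 T)) := fun n =>
    memLp_two_of_continuousOn (hYc n).continuousOn
  have hfm : ∀ n, MemLp (f n) 2 (volume.restrict (Ioo 0 T)) := fun n =>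
    memLp_two_of_continuousOn (hfl n).cont_F.continuousOn
  have hgm : ∀ n, MemLp (g n) 2 (volume.restrict (Ioo 0 T)) := fun n =>
    memLp_two_of_continuousOn (hfl n).cont_g.continuousOn
  let a : ℕ → ℝ := fun n => 2 * (‖S.P‖ * ‖S.K (Y n 0) - h₀‖ ^ 2
    + (∫ t in (0 : ℝ)..T, ‖f n t - F t‖ ^ 2) + (∫ t in (0 : ℝ)..T, ‖g n t‖ ^ 2) / S.κ₀)
  have ha : Tendsto a atTop (𝓝 0) := by
    have h1 : Tendsto (fun n => ‖S.K (Y n 0) - h₀‖ ^ 2) atTop (𝓝 0) := by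
      simp only [hY0]
      simpa using (tendsto_iff_norm_sub_tendsto_zero.1 hζ).pow 2
    simpa using ((((h1.const_mul ‖S.P‖).add hf).add (hg.div_const S.κ₀)).const_mul 2)
  have hstab := fun m n => ((hfl m).sub (hfl n)).stability_residual hT
  have hdiff := fun m n => (hfl m).difference_le (hfl n) (h₀ := h₀) hT hF
  let E := Real.exp (T / S.ρ₀)
  have hE : 0 < E := Real.exp_pos _
  -- The velocities `K Y` are Cauchy uniformly in time, so their limit `U` is continuous; `Y` itself
  -- is Cauchy only in `L²(0,T;X)`.
  have hU : ∀ m n, ∀ s ∈ Icc 0 T, ‖S.K (Y m s) - S.K (Y n s)‖ ^ 2 ≤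
      E / S.ρ₀ * a m + E / S.ρ₀ * a n := fun m n s hs => by
    have h1 := (hstab m n).1 s hs
    rw [← map_sub, ← mul_add, div_mul_eq_mul_div, le_div_iff₀ hρ, mul_comm _ S.ρ₀, mul_comm E]
    exact h1.trans (mul_le_mul_of_nonneg_right (hdiff m n) hE.le)
  obtain ⟨U, hUc, hUb⟩ := exists_uniform_limit hKYc (by simpa using ha.const_mul (E / S.ρ₀)) hU
  obtain ⟨y, hym, hy⟩ := exists_L2_limit hT hYm fun ε hε => by
    obtain ⟨N, hN⟩ := exists_forall_add_le (a := fun n => E / S.κ₀ * a n)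
      (by simpa using ha.const_mul (E / S.κ₀)) hε
    refine ⟨N, fun m hm n hn => le_trans ?_ (hN m hm n hn)⟩
    have h1 := (hstab m n).2
    rw [← mul_add, div_mul_eq_mul_div, le_div_iff₀ hκ, mul_comm _ S.κ₀, mul_comm E]
    exact h1.trans (mul_le_mul_of_nonneg_right (hdiff m n) hE.le)
  have hUL : Tendsto (fun n => ∫ t in (0 : ℝ)..T, ‖S.K (Y n t) - U t‖ ^ 2) atTop (𝓝 0) :=
    tendsto_L2_of_pointwise_bound hT (by simpa using ha.const_mul (E / S.ρ₀))
      (fun n => (hKYc n).continuousOn) hUc hUb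
  have hUp : ∀ s ∈ Icc 0 T, Tendsto (fun n => S.K (Y n s)) atTop (𝓝 (U s)) := fun s hs => by
    rw [tendsto_iff_norm_sub_tendsto_zero]
    have h1 : Tendsto (fun n => √(E / S.ρ₀ * a n)) atTop (𝓝 0) := by
      simpa using (ha.const_mul (E / S.ρ₀)).sqrt
    exact squeeze_zero (fun _ => norm_nonneg _) (fun n => Real.le_sqrt_of_sq_le (hUb n s hs)) h1
  have hUm : MemLp U 2 (volume.restrict (Ioo 0 T)) := memLp_two_of_continuousOn hUc
  have hKYm : ∀ n, MemLp (fun t => S.K (Y n t)) 2 (volume.restrict (Ioo 0 T)) := fun n =>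
    memLp_two_of_continuousOn (hKYc n).continuousOn
  have hZp : ∀ s ∈ Icc 0 T, Tendsto (fun n => Z n s) atTop (𝓝 (∫ t in (0 : ℝ)..s, y t)) :=
    fun s hs => (tendsto_integral_of_L2 hYm hym hy hs).congr fun n =>
      ((hfl n).Z_eq_integral s).symm
  have hzc : ContinuousOn (fun s => ∫ t in (0 : ℝ)..s, y t) (Icc 0 T) :=
    continuousOn_primitive hym hT
  have hZc : ∀ n, ContinuousOn (Z n) (Icc 0 T) := fun n => (hfl n).cont_Z.continuousOn
  have hZL : Tendsto (fun n => ∫ t in (0 : ℝ)..T, ‖Z n t - ∫ τ in (0 : ℝ)..t, y τ‖ ^ 2)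
      atTop (𝓝 0) := by
    refine tendsto_L2_of_pointwise_bound hT (a := fun n => T * ∫ t in (0 : ℝ)..T, ‖Y n t - y t‖ ^ 2)
      (by simpa using hy.const_mul T) hZc hzc fun n s hs => ?_
    rw [(hfl n).Z_eq_integral, ← intervalIntegral.integral_sub
      (MemLp.intervalIntegrable_two (hYm n) hs) (MemLp.intervalIntegrable_two hym hs)]
    exact sq_norm_integral_le ((hYm n).sub hym) hs
  have hg' : Tendsto (fun n => ∫ t in (0 : ℝ)..T, ‖g n t - 0‖ ^ 2) atTop (𝓝 0) := by simpa using hg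
  have h0 : U 0 = h₀ := tendsto_nhds_unique (hUp 0 ⟨le_rfl, hT⟩) (by simpa only [hY0] using hζ)
  have hlim0 : Tendsto (fun n => S.K (Y n 0)) atTop (𝓝 h₀) := by simpa only [hY0] using hζ
  refine ⟨y, U, ⟨hym, hUc, h0, fun s hs => ?_, fun s hs ξ => ?_, fun s hs => ?_⟩, ?_⟩
  · refine tendsto_nhds_unique ((S.K.continuous.tendsto _).comp (hZp s hs)) ?_
    refine (tendsto_integral_of_L2 hKYm hUm hUL hs).congr fun n => ?_
    rw [Function.comp_apply, (hfl n).Z_eq_integral]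
    exact S.K.intervalIntegral_comp_comm (MemLp.intervalIntegrable_two (hYm n) hs)
  · have t₁ := tendsto_integral_clm_of_L2 hfm hF hf (innerSL ℝ (S.K ξ)) hs
    have t₂ := tendsto_integral_clm_of_L2 hgm (y := fun _ => 0) MemLp.zero' hg' (innerSL ℝ ξ) hs
    have t₃ := tendsto_integral_clm_of_L2 hKYm hUm hUL (innerSL ℝ (S.K ξ) ∘L S.Q) hs
    have t₄ := tendsto_integral_clm_of_L2 (fun n => memLp_two_of_continuousOn (hZc n))
      (memLp_two_of_continuousOn hzc) hZL (innerSL ℝ ξ ∘L S.R) hs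
    have t₅ := tendsto_integral_clm_of_L2 hYm hym hy (innerSL ℝ ξ ∘L S.C) hs
    simp only [ContinuousLinearMap.comp_apply, innerSL_apply_apply, fun x => real_inner_comm x (S.K ξ),
      fun x => real_inner_comm x ξ, inner_zero_left, intervalIntegral.integral_zero] at t₁ t₂ t₃ t₄ t₅
    have l : Tendsto (fun n => (inner ℝ (S.P (S.K (Y n s))) (S.K ξ) : ℝ)) atTop
        (𝓝 (inner ℝ (S.P (U s)) (S.K ξ))) :=
      ((S.P.continuous.tendsto _).comp (hUp s hs)).inner tendsto_const_nhds
    have l₀ : Tendsto (fun n => (inner ℝ (S.P (S.K (Y n 0))) (S.K ξ) : ℝ)) atTop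
        (𝓝 (inner ℝ (S.P h₀) (S.K ξ))) :=
      ((S.P.continuous.tendsto _).comp hlim0).inner tendsto_const_nhds
    have r := l₀.add ((((t₁.add t₂).sub t₃).sub t₄).sub t₅)
    rw [add_zero] at r
    exact tendsto_nhds_unique l (r.congr fun n => ((hfl n).weak_eq ξ s).symm)
  · have p : ∀ {u : ℕ → H} {v : H}, Tendsto u atTop (𝓝 v) →
        Tendsto (fun n => (inner ℝ (S.P (u n)) (u n) : ℝ)) atTop (𝓝 (inner ℝ (S.P v) v)) :=
      fun hu => ((S.P.continuous.tendsto _).comp hu).inner hu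
    have l₁ := p (hUp s hs)
    have l₂ : Tendsto (fun n => (inner ℝ (S.R (Z n s)) (Z n s) : ℝ)) atTop
        (𝓝 (inner ℝ (S.R (∫ t in (0 : ℝ)..s, y t)) (∫ t in (0 : ℝ)..s, y t))) :=
      ((S.R.continuous.tendsto _).comp (hZp s hs)).inner (hZp s hs)
    have l₃ := tendsto_integral_norm_sq_of_L2 hYm hym hy hs
    have r₁ := p hlim0
    have r₂ := tendsto_integral_norm_sq_of_L2 hfm hF hf hs
    have r₃ := tendsto_integral_norm_sq_of_L2 hKYm hUm hUL hs
    -- Polarisation: `2 (g, Y) = ‖Y + g‖² - ‖Y‖² - ‖g‖²`, and `Y + g` has the same `L²` limit as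
    -- `Y`.
    have r₄ : Tendsto (fun n => 2 * ∫ t in (0 : ℝ)..s, (inner ℝ (g n t) (Y n t) : ℝ)) atTop
        (𝓝 0) := by
      have q : Tendsto (fun n => ∫ t in (0 : ℝ)..T, ‖(Y n t + g n t) - y t‖ ^ 2) atTop (𝓝 0) := by
        refine squeeze_zero (fun n => intervalIntegral.integral_nonneg hT fun _ _ => by positivity)
          (fun n => ?_) (by simpa using (hy.const_mul 2).add (hg.const_mul 2))
        have := integral_norm_sub_sq_le hT ((hYm n).sub hym) (hgm n).neg
        simpa only [Pi.sub_apply, Pi.neg_apply, sub_neg_eq_add, norm_neg, sub_add_eq_add_sub]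
          using this
      have q₁ := tendsto_integral_norm_sq_of_L2 (fun n => (hYm n).add (hgm n)) hym q hs
      have q₂ := tendsto_integral_norm_sq_of_L2 hgm (y := fun _ => 0) MemLp.zero' hg' hs
      have q₃ := (q₁.sub l₃).sub q₂
      simp only [norm_zero, ne_eq, OfNat.ofNat_ne_zero, not_false_eq_true, zero_pow,
        intervalIntegral.integral_zero, sub_self] at q₃
      refine q₃.congr fun n => ?_
      rw [← intervalIntegral.integral_sub
        (MemLp.intervalIntegrable_norm_sq ((hYm n).add (hgm n)) hs)
        (MemLp.intervalIntegrable_norm_sq (hYm n) hs), ← intervalIntegral.integral_sub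
        ((MemLp.intervalIntegrable_norm_sq ((hYm n).add (hgm n)) hs).sub
          (MemLp.intervalIntegrable_norm_sq (hYm n) hs))
        (MemLp.intervalIntegrable_norm_sq (hgm n) hs), ← intervalIntegral.integral_const_mul]
      refine intervalIntegral.integral_congr fun t _ => ?_
      simp only [Pi.add_apply]
      rw [norm_add_sq_real, real_inner_comm]; ring
    have L := (l₁.add l₂).add (l₃.const_mul (2 * S.κ₀))
    have R := ((r₁.add r₂).add r₃).add r₄
    rw [add_zero] at R
    exact le_of_tendsto_of_tendsto' L R fun n => (hfl n).energy_le hs.1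
  · rintro ⟨B, hB⟩
    have hc : ∀ n, Continuous fun t => S.K (Y' n t) := fun n =>
      S.K.continuous.comp (hfl n).cont_Y'
    -- For bounded `ζ` the accelerations `K Y'` are bounded in `L²`, and their primitives converge
    -- to `U s - U 0`.
    obtain ⟨V, hV, hVe⟩ := exists_L2_derivative hT (V := fun n t => S.K (Y' n t))
      (W := fun s => U s - U 0) (B := M * (1 + B ^ 2))
      (fun n => memLp_two_of_continuousOn (hc n).continuousOn)
      (fun n => (hMb n).trans (by gcongr; exact hB n)) fun s hs => by
        refine ((hUp s hs).sub (hUp 0 ⟨le_rfl, hT⟩)).congr fun n => ?_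
        exact (intervalIntegral.integral_eq_sub_of_hasDerivAt (fun t _ =>
          S.K.hasFDerivAt.comp_hasDerivAt t ((hfl n).deriv_Y t))
          ((hc n).intervalIntegrable 0 s)).symm
    exact ⟨V, hV, fun s hs => by rw [← hVe s hs]; abel⟩

end DampedSystem

/-! ### Time reversal -/

section Reflection

variable {E : Type*} [NormedAddCommGroup E] {T : ℝ}

theorem reflect_mem_Icc {t : ℝ} (ht : t ∈ Icc 0 T) : T - t ∈ Icc 0 T :=
  ⟨sub_nonneg.2 ht.2, sub_le_self _ ht.1⟩

theorem memLp_reflect {f : ℝ → E} (hf : MemLp f 2 (volume.restrict (Ioo 0 T))) :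
    MemLp (fun t => f (T - t)) 2 (volume.restrict (Ioo 0 T)) := by
  have h : MeasurePreserving (fun t => T - t) (volume.restrict (Ioo 0 T))
      (volume.restrict (Ioo 0 T)) := by
    have h1 := (Measure.measurePreserving_sub_left (volume : Measure ℝ) T).restrict_preimage
      (measurableSet_Ioo (a := (0 : ℝ)) (b := T))
    simpa using h1
  exact hf.comp_measurePreserving h

theorem integral_reflect [NormedSpace ℝ E] (f : ℝ → E) :
    ∫ t in (0 : ℝ)..T, f (T - t) = ∫ t in (0 : ℝ)..T, f t := by
  simp

end Reflection

/-! ### Calculus of `H¹` functions on an interval -/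

section Sobolev

variable {E : Type*} [NormedAddCommGroup E] [NormedSpace ℝ E] {T : ℝ}

theorem isH1_primitive {v : ℝ → E} (hv : MemLp v 2 (volume.restrict (Ioo 0 T))) (c : E) :
    IsH1 0 T (fun s => c + ∫ t in (0 : ℝ)..s, v t) v :=
  ⟨hv, fun t _ => by simp⟩

namespace IsH1

variable {u u' v v' : ℝ → E}

theorem intervalIntegrable (h : IsH1 0 T u u') {s : ℝ} (hs : s ∈ Icc 0 T) :
    IntervalIntegrable u' volume 0 s :=
  MemLp.intervalIntegrable_two h.memLp hs

theorem continuousOn (h : IsH1 0 T u u') (hT : 0 ≤ T) : ContinuousOn u (Icc 0 T) :=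
  (continuousOn_const.add (continuousOn_primitive h.memLp hT)).congr h.eq_integral

theorem memLp_self (h : IsH1 0 T u u') (hT : 0 ≤ T) : MemLp u 2 (volume.restrict (Ioo 0 T)) :=
  memLp_two_of_continuousOn (h.continuousOn hT)

theorem congr (h : IsH1 0 T u u') (hT : 0 ≤ T) (hv : ∀ t ∈ Icc 0 T, v t = u t)
    (hv' : ∀ t ∈ Icc 0 T, v' t = u' t) : IsH1 0 T v v' where
  memLp := h.memLp.ae_eq ((ae_restrict_iff' measurableSet_Ioo).2
    (.of_forall fun t ht => (hv' t (Ioo_subset_Icc_self ht)).symm))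
  eq_integral t ht := by
    rw [hv t ht, hv 0 ⟨le_rfl, hT⟩, h.eq_integral t ht]
    congr 1
    refine intervalIntegral.integral_congr fun s hs => ?_
    rw [uIcc_of_le ht.1] at hs
    exact (hv' s ⟨hs.1, hs.2.trans ht.2⟩).symm

theorem add (hu : IsH1 0 T u u') (hv : IsH1 0 T v v') :
    IsH1 0 T (fun t => u t + v t) (fun t => u' t + v' t) where
  memLp := hu.memLp.add hv.memLp
  eq_integral t ht := by
    rw [intervalIntegral.integral_add (hu.intervalIntegrable ht) (hv.intervalIntegrable ht),
      hu.eq_integral t ht, hv.eq_integral t ht]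
    abel

theorem neg (hu : IsH1 0 T u u') : IsH1 0 T (fun t => -u t) (fun t => -u' t) where
  memLp := hu.memLp.neg
  eq_integral t ht := by
    rw [intervalIntegral.integral_neg, hu.eq_integral t ht]
    abel

theorem sub (hu : IsH1 0 T u u') (hv : IsH1 0 T v v') :
    IsH1 0 T (fun t => u t - v t) (fun t => u' t - v' t) := by
  simpa only [sub_eq_add_neg] using hu.add hv.neg

theorem clm [CompleteSpace E] {E₂ : Type*} [NormedAddCommGroup E₂] [NormedSpace ℝ E₂]
    [CompleteSpace E₂] (A : E →L[ℝ] E₂) (hu : IsH1 0 T u u') :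
    IsH1 0 T (fun t => A (u t)) (fun t => A (u' t)) where
  memLp := A.comp_memLp' hu.memLp
  eq_integral t ht := by
    rw [A.intervalIntegral_comp_comm (hu.intervalIntegrable ht), hu.eq_integral t ht, map_add]

theorem smul_const [CompleteSpace E] {f f' : ℝ → ℝ} (hf : IsH1 0 T f f') (x : E) :
    IsH1 0 T (fun t => f t • x) (fun t => f' t • x) :=
  hf.clm ((ContinuousLinearMap.id ℝ ℝ).smulRight x)

theorem reflect (hu : IsH1 0 T u u') :
    IsH1 0 T (fun t => u (T - t)) (fun t => -u' (T - t)) where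
  memLp := (memLp_reflect hu.memLp).neg
  eq_integral t ht := by
    have hT : T ∈ Icc 0 T := ⟨ht.1.trans ht.2, le_rfl⟩
    have ht' := reflect_mem_Icc ht
    have e := intervalIntegral.integral_comp_sub_left (a := 0) (b := t) (fun s => u' s) T
    rw [intervalIntegral.integral_neg, e, sub_zero, hu.eq_integral _ ht', hu.eq_integral T hT,
      ← intervalIntegral.integral_interval_sub_left (hu.intervalIntegrable hT)
        (hu.intervalIntegrable ht')]
    abel

theorem ae_unique {f g g' : ℝ → ℝ} (hT : 0 ≤ T) (h₁ : IsH1 0 T f g) (h₂ : IsH1 0 T f g') :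
    ∀ᵐ t ∂(volume.restrict (Ioo 0 T)), g t = g' t := by
  have h := ae_eq_zero_of_primitive hT ((h₁.memLp.sub h₂.memLp).integrable (by norm_num))
    fun s hs => by
      simp only [Pi.sub_apply]
      rw [intervalIntegral.integral_sub (h₁.intervalIntegrable hs) (h₂.intervalIntegrable hs)]
      linarith [h₁.eq_integral s hs, h₂.eq_integral s hs]
  filter_upwards [h] with t ht using sub_eq_zero.1 ht

/-- The sharp trace inequality at the right end point. -/
theorem sq_right_le {f f' : ℝ → ℝ} (hT : 0 < T) (h : IsH1 0 T f f') :
    f T ^ 2 ≤ 2 * max (1 / T) (T / 3) *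
      ((∫ t in (0 : ℝ)..T, f t ^ 2) + ∫ t in (0 : ℝ)..T, f' t ^ 2) := by
  have hTm : T ∈ Icc 0 T := ⟨hT.le, le_rfl⟩
  have hf := h.memLp_self hT.le
  have hi := h.intervalIntegrable hTm
  have hid : AbsolutelyContinuousOnInterval (fun t : ℝ => t) 0 T :=
    (LipschitzWith.id.lipschitzOnWith (s := uIcc 0 T)).absolutelyContinuousOnInterval
  have hI := hi.absolutelyContinuousOnInterval_intervalIntegral (c := 0) (by simp)
  -- The trace comes from `T f(T) = ∫ (t f)' = ∫ f + ∫ t f'`. As `f'` exists only almost everywhere,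
  -- the integration by parts is the absolutely continuous one.
  have hparts := hid.integral_mul_deriv_eq_deriv_mul hI
  have hd : ∫ t in (0 : ℝ)..T, t * deriv (fun x => ∫ s in (0 : ℝ)..x, f' s) t =
      ∫ t in (0 : ℝ)..T, t * f' t := by
    refine intervalIntegral.integral_congr_ae ?_
    filter_upwards [hi.ae_hasDerivAt_integral] with x hx hx'
    rw [(hx (uIoc_subset_uIcc hx') 0 (by simp)).deriv]
  simp only [hd, deriv_id'', one_mul, zero_mul, sub_zero] at hparts
  have i₁ : IntervalIntegrable f volume 0 T := MemLp.intervalIntegrable_two hf hTm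
  have hprim : ∫ t in (0 : ℝ)..T, (∫ s in (0 : ℝ)..t, f' s) =
      (∫ t in (0 : ℝ)..T, f t) - T * f 0 := by
    have : ∫ t in (0 : ℝ)..T, (∫ s in (0 : ℝ)..t, f' s) = ∫ t in (0 : ℝ)..T, (f t - f 0) := by
      refine intervalIntegral.integral_congr fun t ht => ?_
      rw [uIcc_of_le hT.le] at ht
      simp only [h.eq_integral t ht]; ring
    rw [this, intervalIntegral.integral_sub i₁ intervalIntegrable_const]
    simp
  have key : T * f T = (∫ t in (0 : ℝ)..T, f t) + ∫ t in (0 : ℝ)..T, t * f' t := by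
    rw [hparts, hprim, h.eq_integral T hTm]; ring
  have i₂ : IntervalIntegrable (fun t => f t ^ 2) volume 0 T := by
    simpa using MemLp.intervalIntegrable_norm_sq hf hTm
  have i₃ : IntervalIntegrable (fun t => f' t ^ 2) volume 0 T := by
    simpa using MemLp.intervalIntegrable_norm_sq h.memLp hTm
  have c₁ := sq_integral_le hT.le i₁ i₂
  have c₂ := sq_integral_mul_le (f := fun t => t) hT.le
    ((continuous_pow 2).intervalIntegrable _ _) i₃ (hi.continuousOn_mul continuousOn_id)
  rw [integral_pow] at c₂
  norm_num at c₂
  set A := ∫ t in (0 : ℝ)..T, f t ^ 2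
  set B := ∫ t in (0 : ℝ)..T, f' t ^ 2
  have hA : 0 ≤ A := intervalIntegral.integral_nonneg hT.le fun _ _ => sq_nonneg _
  have hB : 0 ≤ B := intervalIntegral.integral_nonneg hT.le fun _ _ => sq_nonneg _
  -- By `(a + b)² ≤ 2 a² + 2 b²` and Cauchy–Schwarz on each integral; `T / 3` comes from `∫ t² = T³
  -- / 3`.
  have h1 : T ^ 2 * f T ^ 2 ≤ T ^ 2 * (2 * (1 / T * A + T / 3 * B)) := by
    have e : T ^ 2 * (2 * (1 / T * A + T / 3 * B)) = 2 * (T * A) + 2 * (T ^ 3 / 3 * B) := by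
      field_simp
    rw [e, ← mul_pow, key]
    nlinarith [sq_nonneg ((∫ t in (0 : ℝ)..T, f t) - ∫ t in (0 : ℝ)..T, t * f' t)]
  have h2 := le_of_mul_le_mul_left h1 (by positivity)
  have h3 : 1 / T * A ≤ max (1 / T) (T / 3) * A := by gcongr; exact le_max_left _ _
  have h4 : T / 3 * B ≤ max (1 / T) (T / 3) * B := by gcongr; exact le_max_right _ _
  linarith

end IsH1

end Sobolev

/-! ### Multiplication and Volterra operators on `L²(0,ℓ)` -/

section Operators

variable {ℓ : ℝ}

/-- Multiplication by a bounded function as an operator on `L²(0,ℓ)`. -/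
noncomputable def mulOp {w : ℝ → ℝ} (hw : MemLp w ⊤ (volume.restrict (Ioo 0 ℓ))) :
    L2 ℓ →L[ℝ] L2 ℓ :=
  (ContinuousLinearMap.mul ℝ ℝ).holderL (volume.restrict (Ioo 0 ℓ)) ⊤ 2 2 hw.toLp

theorem coeFn_mulOp {w : ℝ → ℝ} (hw : MemLp w ⊤ (volume.restrict (Ioo 0 ℓ))) (f : L2 ℓ) :
    mulOp hw f =ᵐ[volume.restrict (Ioo 0 ℓ)] fun x => w x * f x := by
  filter_upwards [(ContinuousLinearMap.mul ℝ ℝ).coeFn_holder (r := 2) (hw.toLp w) f,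
    hw.coeFn_toLp] with x h1 h2
  rw [← h2]; exact h1

theorem inner_mulOp {w : ℝ → ℝ} (hw : MemLp w ⊤ (volume.restrict (Ioo 0 ℓ))) (f g : L2 ℓ)
    {v : ℝ → ℝ} (hv : v =ᵐ[volume.restrict (Ioo 0 ℓ)] g) :
    inner ℝ (mulOp hw f) g = pairing ℓ w f v := by
  rw [L2.inner_def, pairing]
  refine integral_congr_ae ?_
  filter_upwards [coeFn_mulOp hw f, hv] with x h1 h2
  rw [h1, h2]
  simp [mul_comm]

theorem mulOp_symm {w : ℝ → ℝ} (hw : MemLp w ⊤ (volume.restrict (Ioo 0 ℓ))) (f g : L2 ℓ) :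
    inner ℝ (mulOp hw f) g = inner ℝ f (mulOp hw g) := by
  rw [real_inner_comm _ f, inner_mulOp hw f g (ae_eq_refl _), inner_mulOp hw g f (ae_eq_refl _)]
  simp only [pairing, mul_right_comm]

theorem norm_sq_eq (f : L2 ℓ) : ‖f‖ ^ 2 = ∫ x in Ioo 0 ℓ, f x ^ 2 := by
  have := norm_toLp_sq (Lp.memLp f)
  simpa using this

theorem integrable_sq (f : L2 ℓ) : Integrable (fun x => f x ^ 2) (volume.restrict (Ioo 0 ℓ)) :=
  (Lp.memLp f).integrable_sq

theorem inner_mulOp_self {w : ℝ → ℝ} (hw : MemLp w ⊤ (volume.restrict (Ioo 0 ℓ))) (f : L2 ℓ) :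
    inner ℝ (mulOp hw f) f = ∫ x in Ioo 0 ℓ, w x * f x ^ 2 := by
  rw [inner_mulOp hw f f (ae_eq_refl _), pairing]
  simp only [sq, mul_assoc]

theorem integrable_mul_sq {w : ℝ → ℝ} (hw : MemLp w ⊤ (volume.restrict (Ioo 0 ℓ))) (f : L2 ℓ) :
    Integrable (fun x => w x * f x ^ 2) (volume.restrict (Ioo 0 ℓ)) := by
  refine (L2.integrable_inner (𝕜 := ℝ) (mulOp hw f) f).congr ?_
  filter_upwards [coeFn_mulOp hw f] with x h1
  rw [h1]
  simp only [RCLike.inner_apply, conj_trivial]; ring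

theorem mulOp_coercive {w : ℝ → ℝ} (hw : MemLp w ⊤ (volume.restrict (Ioo 0 ℓ))) {c : ℝ}
    (h : ∀ᵐ x ∂(volume.restrict (Ioo 0 ℓ)), c ≤ w x) (f : L2 ℓ) :
    c * ‖f‖ ^ 2 ≤ inner ℝ (mulOp hw f) f := by
  rw [inner_mulOp_self, norm_sq_eq, ← integral_const_mul]
  refine integral_mono_ae ((integrable_sq f).const_mul c) (integrable_mul_sq hw f) ?_
  filter_upwards [h] with x hx
  gcongr

theorem inner_mulOp_self_le {w : ℝ → ℝ} (hw : MemLp w ⊤ (volume.restrict (Ioo 0 ℓ))) {c : ℝ}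
    (h : ∀ᵐ x ∂(volume.restrict (Ioo 0 ℓ)), w x ≤ c) (f : L2 ℓ) :
    inner ℝ (mulOp hw f) f ≤ c * ‖f‖ ^ 2 := by
  rw [inner_mulOp_self, norm_sq_eq, ← integral_const_mul]
  refine integral_mono_ae (integrable_mul_sq hw f) ((integrable_sq f).const_mul c) ?_
  filter_upwards [h] with x hx
  gcongr

theorem norm_mulOp_sq_le {w : ℝ → ℝ} (hw : MemLp w ⊤ (volume.restrict (Ioo 0 ℓ))) {c : ℝ}
    (h : ∀ᵐ x ∂(volume.restrict (Ioo 0 ℓ)), 0 ≤ w x ∧ w x ≤ c) (f : L2 ℓ) :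
    ‖mulOp hw f‖ ^ 2 ≤ c ^ 2 * ‖f‖ ^ 2 := by
  rw [norm_sq_eq, norm_sq_eq, ← integral_const_mul]
  refine integral_mono_ae (integrable_sq _) ((integrable_sq f).const_mul _) ?_
  filter_upwards [h, coeFn_mulOp hw f] with x hx h1
  rw [h1, mul_pow]
  have := hx.1
  have := hx.2
  gcongr

theorem primitive_congr {f g : ℝ → ℝ} (h : f =ᵐ[volume.restrict (Ioo 0 ℓ)] g) {x : ℝ}
    (hx : x ∈ Icc 0 ℓ) : ∫ y in (0 : ℝ)..x, f y = ∫ y in (0 : ℝ)..x, g y := by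
  rw [intervalIntegral.integral_of_le hx.1, intervalIntegral.integral_of_le hx.1,
    integral_Ioc_eq_integral_Ioo, integral_Ioc_eq_integral_Ioo]
  exact integral_congr_ae (ae_restrict_of_ae_restrict_of_subset (Ioo_subset_Ioo_right hx.2) h)

theorem ae_of_forall_Icc {p : ℝ → Prop} (h : ∀ x ∈ Icc 0 ℓ, p x) :
    ∀ᵐ x ∂(volume.restrict (Ioo 0 ℓ)), p x :=
  (ae_restrict_iff' measurableSet_Ioo).2 (.of_forall fun x hx => h x (Ioo_subset_Icc_self hx))

theorem memLp_primitive (hℓ : 0 ≤ ℓ) (z : L2 ℓ) :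
    MemLp (fun x => ∫ y in (0 : ℝ)..x, z y) 2 (volume.restrict (Ioo 0 ℓ)) :=
  memLp_two_of_continuousOn (continuousOn_primitive (Lp.memLp z) hℓ)

/-- The Volterra operator `z ↦ ∫₀ˣ z` on `L²(0,ℓ)`. -/
noncomputable def volterra (hℓ : 0 ≤ ℓ) : L2 ℓ →L[ℝ] L2 ℓ :=
  LinearMap.mkContinuous
    { toFun := fun z => (memLp_primitive hℓ z).toLp
      map_add' := fun z w => by
        rw [← MemLp.toLp_add]
        refine MemLp.toLp_congr _ _ (ae_of_forall_Icc fun x hx => ?_)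
        beta_reduce
        rw [primitive_congr (Lp.coeFn_add z w) hx, Pi.add_apply]
        exact intervalIntegral.integral_add (MemLp.intervalIntegrable_two (Lp.memLp z) hx)
          (MemLp.intervalIntegrable_two (Lp.memLp w) hx)
      map_smul' := fun c z => by
        rw [RingHom.id_apply, ← MemLp.toLp_const_smul]
        refine MemLp.toLp_congr _ _ (ae_of_forall_Icc fun x hx => ?_)
        beta_reduce
        rw [primitive_congr (Lp.coeFn_smul c z) hx, Pi.smul_apply]
        exact intervalIntegral.integral_smul c _ }
    ℓ fun z => by
      refine abs_le_of_sq_le_sq' ?_ (by positivity) |>.2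
      change ‖(memLp_primitive hℓ z).toLp _‖ ^ 2 ≤ _
      have hz := norm_toLp_sq_interval hℓ (Lp.memLp z)
      rw [Lp.toLp_coeFn] at hz
      rw [norm_toLp_sq_interval hℓ, mul_pow, hz]
      calc _ ≤ ∫ x in (0 : ℝ)..ℓ, ℓ * ∫ t in (0 : ℝ)..ℓ, ‖z t‖ ^ 2 :=
            intervalIntegral.integral_mono_on hℓ
              (MemLp.intervalIntegrable_norm_sq (memLp_primitive hℓ z) ⟨hℓ, le_rfl⟩)
              intervalIntegrable_const fun x hx => sq_norm_integral_le (Lp.memLp z) hx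
        _ = _ := by rw [intervalIntegral.integral_const, smul_eq_mul]; ring

theorem coeFn_volterra (hℓ : 0 ≤ ℓ) (z : L2 ℓ) :
    volterra hℓ z =ᵐ[volume.restrict (Ioo 0 ℓ)] fun x => ∫ y in (0 : ℝ)..x, z y :=
  (memLp_primitive hℓ z).coeFn_toLp

theorem coeFn_volterra_of_ae_eq (hℓ : 0 ≤ ℓ) {z : L2 ℓ} {f : ℝ → ℝ}
    (hf : z =ᵐ[volume.restrict (Ioo 0 ℓ)] f) :
    volterra hℓ z =ᵐ[volume.restrict (Ioo 0 ℓ)] fun x => ∫ y in (0 : ℝ)..x, f y := by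
  filter_upwards [coeFn_volterra hℓ z, ae_of_forall_Icc fun x hx => primitive_congr hf hx]
    with x h1 h2
  rw [h1, h2]

/-- The constant function `1` in `L²(0,ℓ)`. -/
noncomputable def unit (ℓ : ℝ) : L2 ℓ :=
  (memLp_const (1 : ℝ) : MemLp (fun _ : ℝ => (1 : ℝ)) 2 (volume.restrict (Ioo 0 ℓ))).toLp

theorem coeFn_unit : unit ℓ =ᵐ[volume.restrict (Ioo 0 ℓ)] fun _ => (1 : ℝ) :=
  MemLp.coeFn_toLp _

theorem coeFn_volterra_unit (hℓ : 0 ≤ ℓ) :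
    volterra hℓ (unit ℓ) =ᵐ[volume.restrict (Ioo 0 ℓ)] fun x => x := by
  simpa using coeFn_volterra_of_ae_eq hℓ (coeFn_unit (ℓ := ℓ))

theorem norm_volterra_unit_sq (hℓ : 0 ≤ ℓ) : ‖volterra hℓ (unit ℓ)‖ ^ 2 = ℓ ^ 3 / 3 := by
  rw [norm_sq_eq]
  have : ∫ x in Ioo 0 ℓ, (volterra hℓ (unit ℓ)) x ^ 2 = ∫ x in Ioo 0 ℓ, x ^ 2 :=
    integral_congr_ae (by filter_upwards [coeFn_volterra_unit hℓ] with x hx; rw [hx])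
  rw [this, ← integral_Ioc_eq_integral_Ioo, ← intervalIntegral.integral_of_le hℓ, integral_pow]
  norm_num

/-- The constants lie in the closure of the range of the Volterra operator. -/
theorem exists_tendsto_volterra (hℓ : 0 ≤ ℓ) :
    ∃ z : ℕ → L2 ℓ, Tendsto (fun n => volterra hℓ (z n)) atTop (𝓝 (unit ℓ)) := by
  -- The approximants are `a exp(-a x)` with `a = n + 1`: their primitive `1 - exp(-a x)` misses `1`
  -- by `exp(-a x)`, whose squared norm is at most `1 / (2 a)`.
  have hc : ∀ n : ℕ, Continuous fun x : ℝ => ((n : ℝ) + 1) * Real.exp (-((n + 1) * x)) :=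
    fun n => by fun_prop
  have hm : ∀ n : ℕ, MemLp (fun x : ℝ => ((n : ℝ) + 1) * Real.exp (-((n + 1) * x))) 2
      (volume.restrict (Ioo 0 ℓ)) := fun n => memLp_two_of_continuousOn (hc n).continuousOn
  have hint : ∀ (a x : ℝ), ∫ y in (0 : ℝ)..x, a * Real.exp (-(a * y)) = 1 - Real.exp (-(a * x)) :=
    fun a x => by
      have hd : ∀ y, HasDerivAt (fun y => -Real.exp (-(a * y))) (a * Real.exp (-(a * y))) y :=
        fun y => by
          refine (((hasDerivAt_id y).const_mul a).neg.exp.neg).congr_deriv ?_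
          simp only [Pi.neg_apply, id]; ring
      rw [intervalIntegral.integral_eq_sub_of_hasDerivAt (fun y _ => hd y)
        ((by fun_prop : Continuous fun y => a * Real.exp (-(a * y))).intervalIntegrable _ _)]
      simp; ring
  refine ⟨fun n => (hm n).toLp, ?_⟩
  rw [tendsto_iff_norm_sub_tendsto_zero]
  have hb : ∀ n : ℕ, ‖volterra hℓ (hm n).toLp - unit ℓ‖ ^ 2 ≤ 1 / ((n : ℝ) + 1) := fun n => by
    have ha : (0 : ℝ) < (n : ℝ) + 1 := by positivity
    rw [norm_sq_eq]
    have h1 : ∫ x in Ioo 0 ℓ, (volterra hℓ (hm n).toLp - unit ℓ : L2 ℓ) x ^ 2 =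
        ∫ x in (0 : ℝ)..ℓ, Real.exp (-((2 * ((n : ℝ) + 1)) * x)) := by
      rw [intervalIntegral.integral_of_le hℓ, integral_Ioc_eq_integral_Ioo]
      refine integral_congr_ae ?_
      filter_upwards [coeFn_volterra_of_ae_eq hℓ (hm n).coeFn_toLp, coeFn_unit (ℓ := ℓ),
        Lp.coeFn_sub (volterra hℓ (hm n).toLp) (unit ℓ)] with x h1 h2 h3
      rw [h3, Pi.sub_apply, h1, h2, hint, sub_sub_cancel_left, neg_sq, sq, ← Real.exp_add]
      congr 1; ring
    have h2 := hint (2 * ((n : ℝ) + 1)) ℓ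
    rw [intervalIntegral.integral_const_mul] at h2
    rw [h1, le_div_iff₀ ha]
    have h3 := Real.exp_pos (-(2 * ((n : ℝ) + 1) * ℓ))
    nlinarith
  have hs : Tendsto (fun n : ℕ => √(1 / ((n : ℝ) + 1))) atTop (𝓝 0) := by
    simpa using (tendsto_one_div_add_atTop_nhds_zero_nat (𝕜 := ℝ)).sqrt
  exact squeeze_zero (fun _ => norm_nonneg _) (fun n => Real.le_sqrt_of_sq_le (hb n)) hs

end Operators

/-! ### The beam as a damped system -/

variable {ℓ T : ℝ} {ρ μ r κ : ℝ → ℝ} {ρ₀ ρ₁ μ₀ μ₁ r₀ r₁ κ₀ κ₁ : ℝ}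

theorem memLp_top_of_isH2 {w d₁ d₂ : ℝ → ℝ} (hℓ : 0 ≤ ℓ) (h : IsH2 0 ℓ w d₁ d₂) :
    MemLp w ⊤ (volume.restrict (Ioo 0 ℓ)) := by
  have hc := h.first.continuousOn hℓ
  obtain ⟨C, hC⟩ := isCompact_Icc.exists_bound_of_continuousOn hc
  exact memLp_top_of_bound
    ((hc.mono Ioo_subset_Icc_self).aestronglyMeasurable measurableSet_Ioo) C (ae_of_forall_Icc hC)

namespace Coefficients

theorem r_memLp (h : Coefficients ℓ ρ μ r κ ρ₀ ρ₁ μ₀ μ₁ r₀ r₁ κ₀ κ₁) (hℓ : 0 ≤ ℓ) :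
    MemLp r ⊤ (volume.restrict (Ioo 0 ℓ)) := by
  obtain ⟨d₁, d₂, hd⟩ := h.r_H2
  exact memLp_top_of_isH2 hℓ hd

theorem kappa_memLp (h : Coefficients ℓ ρ μ r κ ρ₀ ρ₁ μ₀ μ₁ r₀ r₁ κ₀ κ₁) (hℓ : 0 ≤ ℓ) :
    MemLp κ ⊤ (volume.restrict (Ioo 0 ℓ)) := by
  obtain ⟨d₁, d₂, hd⟩ := h.kappa_H2
  exact memLp_top_of_isH2 hℓ hd

/-- The beam equation as an abstract damped system, in the unknown `φ_xx`. -/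
noncomputable def system (h : Coefficients ℓ ρ μ r κ ρ₀ ρ₁ μ₀ μ₁ r₀ r₁ κ₀ κ₁) (hℓ : 0 ≤ ℓ) :
    DampedSystem (L2 ℓ) (L2 ℓ) where
  -- The double primitive encodes both conditions at `x = 0`; those at `x = ℓ` are natural and need
  -- no encoding.
  K := volterra hℓ ∘L volterra hℓ
  P := mulOp h.rho_memLp
  Q := mulOp h.mu_memLp
  R := mulOp (h.r_memLp hℓ)
  C := mulOp (h.kappa_memLp hℓ)
  ρ₀ := ρ₀
  r₀ := r₀
  κ₀ := κ₀
  ρ₀_pos := h.rho_pos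
  r₀_pos := h.r_pos
  κ₀_pos := h.kappa_pos
  P_symm := mulOp_symm _
  P_coercive := mulOp_coercive _ (h.rho_bounds.mono fun _ hx => hx.1)
  Q_nonneg f := by
    simpa using mulOp_coercive h.mu_memLp
      (h.mu_bounds.mono fun _ hx => h.mu_nonneg.trans hx.1) f
  R_symm := mulOp_symm _
  R_coercive := mulOp_coercive _ ((ae_restrict_iff' measurableSet_Ioo).2
    (.of_forall fun x hx => (h.r_bounds x hx).1))
  C_symm := mulOp_symm _
  C_coercive := mulOp_coercive _ ((ae_restrict_iff' measurableSet_Ioo).2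
    (.of_forall fun x hx => (h.kappa_bounds x hx).1))

/-- The size of the data produced by the lifting `x θ(t)` of the boundary condition. -/
theorem data_le (h : Coefficients ℓ ρ μ r κ ρ₀ ρ₁ μ₀ μ₁ r₀ r₁ κ₀ κ₁) (hℓ : 0 < ℓ) (hT : 0 < T)
    {θ₁ θ₂ : ℝ → ℝ} (hθ : IsH1 0 T θ₁ θ₂) :
    inner ℝ (mulOp h.rho_memLp (θ₁ T • volterra hℓ.le (unit ℓ)))
        (θ₁ T • volterra hℓ.le (unit ℓ))
      + ∫ t in (0 : ℝ)..T, ‖θ₁ (T - t) • mulOp h.mu_memLp (volterra hℓ.le (unit ℓ))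
        - θ₂ (T - t) • mulOp h.rho_memLp (volterra hℓ.le (unit ℓ))‖ ^ 2 ≤
    C6sq ℓ T ρ₁ μ₁ * G T θ₁ θ₂ := by
  set x := volterra hℓ.le (unit ℓ)
  have hx : ‖x‖ ^ 2 = ℓ ^ 3 / 3 := norm_volterra_unit_sq hℓ.le
  have hθ₁ := hθ.memLp_self hT.le
  have hθ₂ := hθ.memLp
  have hP := inner_mulOp_self_le h.rho_memLp (h.rho_bounds.mono fun _ hx => hx.2) x
  have hP₀ := mulOp_coercive h.rho_memLp (h.rho_bounds.mono fun _ hx => hx.1) x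
  have hPn := norm_mulOp_sq_le h.rho_memLp
    (h.rho_bounds.mono fun _ hx => ⟨h.rho_pos.le.trans hx.1, hx.2⟩) x
  have hQn := norm_mulOp_sq_le h.mu_memLp
    (h.mu_bounds.mono fun _ hx => ⟨h.mu_nonneg.trans hx.1, hx.2⟩) x
  rw [hx] at hP hP₀ hPn hQn
  have hL : 0 < ℓ ^ 3 / 3 := by positivity
  -- The bounds on `ρ` hold only almost everywhere, so `ρ₀ ≤ ρ₁` is read off by comparing both
  -- quadratic bounds at the nonzero vector `x`.
  have hρ₁ : 0 ≤ ρ₁ := h.rho_pos.le.trans (le_of_mul_le_mul_right (hP₀.trans hP) hL)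
  have htr := hθ.sq_right_le hT
  have e : ∀ {f : ℝ → ℝ} (y : L2 ℓ), ∫ t in (0 : ℝ)..T, ‖f (T - t) • y‖ ^ 2 =
      (∫ t in (0 : ℝ)..T, f t ^ 2) * ‖y‖ ^ 2 := fun {f} y => by
    simp only [norm_smul, mul_pow, Real.norm_eq_abs, sq_abs]
    rw [intervalIntegral.integral_mul_const, integral_reflect (fun t => f t ^ 2)]
  have m : ∀ {f : ℝ → ℝ} (y : L2 ℓ), MemLp f 2 (volume.restrict (Ioo 0 T)) →
      MemLp (fun t => f (T - t) • y) 2 (volume.restrict (Ioo 0 T)) := fun y hf =>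
    ((ContinuousLinearMap.id ℝ ℝ).smulRight y).comp_memLp' (memLp_reflect hf)
  have hF := integral_norm_sub_sq_le hT.le (m (mulOp h.mu_memLp x) hθ₁)
    (m (mulOp h.rho_memLp x) hθ₂)
  rw [e, e] at hF
  rw [map_smul, real_inner_smul_left, real_inner_smul_right, G, C6sq]
  set A := ∫ t in (0 : ℝ)..T, θ₁ t ^ 2
  set B := ∫ t in (0 : ℝ)..T, θ₂ t ^ 2
  set M := max (1 / T) (T / 3)
  set N := max (μ₁ ^ 2) (ρ₁ ^ 2)
  have hA : 0 ≤ A := intervalIntegral.integral_nonneg hT.le fun _ _ => sq_nonneg _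
  have hB : 0 ≤ B := intervalIntegral.integral_nonneg hT.le fun _ _ => sq_nonneg _
  have h1 : A * ‖mulOp h.mu_memLp x‖ ^ 2 ≤ A * (N * (ℓ ^ 3 / 3)) := by
    gcongr
    exact hQn.trans (by gcongr; exact le_max_left _ _)
  have h2 : B * ‖mulOp h.rho_memLp x‖ ^ 2 ≤ B * (N * (ℓ ^ 3 / 3)) := by
    gcongr
    exact hPn.trans (by gcongr; exact le_max_right _ _)
  -- The initial velocity involves the point value `θ'(T)`; the trace inequality trades it for `G`,
  -- whence `max (1 / T) (T / 3)` in `C6sq`.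
  have h3 : θ₁ T * (θ₁ T * inner ℝ (mulOp h.rho_memLp x) x) ≤
      2 * M * (A + B) * (ρ₁ * (ℓ ^ 3 / 3)) := by
    rw [← mul_assoc, ← sq]
    calc _ ≤ θ₁ T ^ 2 * (ρ₁ * (ℓ ^ 3 / 3)) := by gcongr
      _ ≤ _ := by gcongr
  linarith

end Coefficients

/-- A test function is the double primitive of its second derivative. -/
theorem IsTest.ae_eq {v v₁ v₂ : ℝ → ℝ} (h : IsTest ℓ v v₁ v₂) (hℓ : 0 ≤ ℓ) :
    v =ᵐ[volume.restrict (Ioo 0 ℓ)]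
      volterra hℓ (volterra hℓ (h.isH2.second.memLp.toLp v₂)) := by
  have h1 := coeFn_volterra_of_ae_eq hℓ h.isH2.second.memLp.coeFn_toLp
  have h2 : volterra hℓ (h.isH2.second.memLp.toLp v₂) =ᵐ[volume.restrict (Ioo 0 ℓ)] v₁ := by
    filter_upwards [h1, ae_of_forall_Icc h.isH2.second.eq_integral] with x h1 h2
    rw [h1, h2, h.deriv_zero, zero_add]
  filter_upwards [coeFn_volterra_of_ae_eq hℓ h2, ae_of_forall_Icc h.isH2.first.eq_integral]
    with x h1 h2
  rw [h1, h2, h.zero, zero_add]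

/-- The profile `x c + ∫₀ˣ∫₀ʸ z` belongs to `H²`, with second derivative `z`. -/
theorem exists_isH2_lift (hℓ : 0 ≤ ℓ) (c : ℝ) (z : L2 ℓ) :
    ∃ F F₁ : ℝ → ℝ, IsH2 0 ℓ F F₁ z ∧
      F =ᵐ[volume.restrict (Ioo 0 ℓ)]
        (c • volterra hℓ (unit ℓ) + volterra hℓ (volterra hℓ z) : L2 ℓ) ∧
      F₁ =ᵐ[volume.restrict (Ioo 0 ℓ)] (c • unit ℓ + volterra hℓ z : L2 ℓ) ∧
      F 0 = 0 ∧ F₁ 0 = c := by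
  have h₁ : IsH1 0 ℓ (fun x => c + ∫ y in (0 : ℝ)..x, z y) z := isH1_primitive (Lp.memLp z) c
  have h₀ := isH1_primitive (h₁.memLp_self hℓ) 0
  have e₁ : (c • unit ℓ + volterra hℓ z : L2 ℓ) =ᵐ[volume.restrict (Ioo 0 ℓ)]
      fun x => c + ∫ y in (0 : ℝ)..x, z y := by
    filter_upwards [Lp.coeFn_add (c • unit ℓ) (volterra hℓ z), Lp.coeFn_smul c (unit ℓ),
      coeFn_unit (ℓ := ℓ), coeFn_volterra hℓ z] with x h1 h2 h3 h4
    rw [h1, Pi.add_apply, h2, Pi.smul_apply, h3, h4, smul_eq_mul, mul_one]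
  refine ⟨_, _, ⟨h₀, h₁⟩, ?_, e₁.symm, by simp, by simp⟩
  rw [← map_smul, ← map_add]
  filter_upwards [coeFn_volterra_of_ae_eq hℓ e₁] with x hx
  rw [hx, zero_add]

end Beam

/-! ### The backward problem -/

open Beam in
/-- Backward adjoint problem with Dirichlet input `θ ∈ H²(0,T)`, `θ(T) = 0`: existence of a weak
solution with explicit bounds; if also `θ'(T) = 0`, then `φ_tt ∈ L²(0,T;L²(0,ℓ))` and the weak
equation holds for almost every time. Here `θ₁ = θ'` and `θ₂ = θ''`. -/
theorem theorem4p2 (ℓ T : ℝ) (hℓ : 0 < ℓ) (hT : 0 < T)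
    (ρ μ r κ : ℝ → ℝ) (ρ₀ ρ₁ μ₀ μ₁ r₀ r₁ κ₀ κ₁ : ℝ)
    (hcoef : Beam.Coefficients ℓ ρ μ r κ ρ₀ ρ₁ μ₀ μ₁ r₀ r₁ κ₀ κ₁)
    (θ θ₁ θ₂ : ℝ → ℝ) (hθ : Beam.IsH2 0 T θ θ₁ θ₂) (hθT : θ T = 0) :
    ∃ φ φx φxx φt φxt φxxt : ℝ → Beam.L2 ℓ,
      Beam.IsWeakSolution ℓ T ρ μ r κ θ φ φx φxx φt φxt φxxt ∧
      (θ₁ T = 0 → Beam.HasL2Acceleration ℓ T ρ μ r κ φxx φt φxxt) ∧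
      ∫ t in (0 : ℝ)..T, ‖φt t‖ ^ 2 ≤
        2 * (Beam.C6sq ℓ T ρ₁ μ₁ * (Real.exp (T / ρ₀) - 1) + ℓ ^ 3 / 3) * Beam.G T θ₁ θ₂ ∧
      ∫ t in (0 : ℝ)..T, ‖φxx t‖ ^ 2 ≤
        T * Beam.C6sq ℓ T ρ₁ μ₁ / r₀ * Real.exp (T / ρ₀) * Beam.G T θ₁ θ₂ ∧
      ∫ t in (0 : ℝ)..T, ‖φxxt t‖ ^ 2 ≤
        Beam.C6sq ℓ T ρ₁ μ₁ / (2 * κ₀) * Real.exp (T / ρ₀) * Beam.G T θ₁ θ₂ := by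
  let J := volterra hℓ.le
  let S := hcoef.system hℓ.le
  let x : L2 ℓ := J (unit ℓ)
  -- Reversing time flips the sign of the first-order terms, so the lift leaves `μ x θ' - ρ x θ''`
  -- on the right.
  let F : ℝ → L2 ℓ := fun s => θ₁ (T - s) • S.Q x - θ₂ (T - s) • S.P x
  have hθ₁ := hθ.second.memLp_self hT.le
  have hθ₂ := hθ.second.memLp
  have hsm : ∀ {f : ℝ → ℝ} (y : L2 ℓ), MemLp f 2 (volume.restrict (Ioo 0 T)) →
      MemLp (fun t => f t • y) 2 (volume.restrict (Ioo 0 T)) := fun y hf =>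
    ((ContinuousLinearMap.id ℝ ℝ).smulRight y).comp_memLp' hf
  have hF : MemLp F 2 (volume.restrict (Ioo 0 T)) :=
    (hsm _ (memLp_reflect hθ₁)).sub (hsm _ (memLp_reflect hθ₂))
  obtain ⟨z, hz⟩ := exists_tendsto_volterra hℓ.le
  -- As `x = J 1` and `J (z n) → 1`, the vectors `K (z n)` converge to `x`.
  have hζ : Tendsto (fun n => S.K (θ₁ T • z n)) atTop (𝓝 (θ₁ T • x)) := by
    have h1 := ((J.continuous.tendsto _).comp hz).const_smul (θ₁ T)
    refine h1.congr fun n => ?_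
    rw [map_smul]; rfl
  obtain ⟨Y, U, hW, hacc⟩ := S.exists_weakFlow hT.le hF hζ
  obtain ⟨b₁, b₂, b₃⟩ := hW.bounds hT.le hF (hcoef.data_le hℓ hT hθ.second)
  let Z : ℝ → L2 ℓ := fun s => ∫ t in (0 : ℝ)..s, Y t
  have hZ : IsH1 0 T Z Y := by simpa using isH1_primitive hW.memLp 0
  have hKZ : IsH1 0 T (fun s => J (J (Z s))) U :=
    ⟨memLp_two_of_continuousOn hW.continuousOn, fun s hs => by
      have h0 : J (J (Z 0)) = 0 := by simp [Z]
      rw [h0, zero_add]; exact hW.K_primitive s hs⟩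
  let φxx : ℝ → L2 ℓ := fun t => Z (T - t)
  -- Built from the continuous `U`, since `K Y` is defined only up to null sets of times; thus `φt T
  -- = 0` holds exactly, by `U 0 = θ₁ T • x`.
  let φt : ℝ → L2 ℓ := fun t => θ₁ t • x - U (T - t)
  let φxxt : ℝ → L2 ℓ := fun t => -Y (T - t)
  have hφt : ContinuousOn φt (Icc 0 T) :=
    ((hθ.second.continuousOn hT.le).smul continuousOn_const).sub
      (hW.continuousOn.comp (by fun_prop) fun t ht => reflect_mem_Icc ht)
  have hweak : ∀ ξ : L2 ℓ, IsH1 0 T (fun t => inner ℝ (S.P (φt t)) (S.K ξ))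
      (fun t => inner ℝ (S.Q (φt t)) (S.K ξ) - inner ℝ (S.R (φxx t)) ξ
        + inner ℝ (S.C (φxxt t)) ξ) := fun ξ => by
    have m : ∀ {u : ℝ → L2 ℓ} (A : L2 ℓ →L[ℝ] L2 ℓ) (y : L2 ℓ),
        MemLp u 2 (volume.restrict (Ioo 0 T)) →
        MemLp (fun t => (inner ℝ (A (u t)) y : ℝ)) 2 (volume.restrict (Ioo 0 T)) :=
      fun {u} A y hu => by
        have := (innerSL ℝ y ∘L A).comp_memLp' hu
        simpa [Function.comp_def, real_inner_comm] using this
    have m₁ : MemLp (fun t => (inner ℝ (F t) (S.K ξ) : ℝ)) 2 (volume.restrict (Ioo 0 T)) :=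
      m (ContinuousLinearMap.id ℝ _) (S.K ξ) hF
    have m₂ := m S.Q (S.K ξ) (memLp_two_of_continuousOn hW.continuousOn)
    have m₃ := m S.R ξ (hZ.memLp_self hT.le)
    have m₄ := m S.C ξ hW.memLp
    have hU : IsH1 0 T (fun s => inner ℝ (S.P (U s)) (S.K ξ)) (fun s => inner ℝ (F s) (S.K ξ)
        - inner ℝ (S.Q (U s)) (S.K ξ) - inner ℝ (S.R (Z s)) ξ - inner ℝ (S.C (Y s)) ξ) := by
      refine ⟨((m₁.sub m₂).sub m₃).sub m₄, fun s hs => ?_⟩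
      have i₁ := MemLp.intervalIntegrable_two m₁ hs
      have i₂ := MemLp.intervalIntegrable_two m₂ hs
      have i₃ := MemLp.intervalIntegrable_two m₃ hs
      have i₄ := MemLp.intervalIntegrable_two m₄ hs
      rw [hW.weak s hs ξ, hW.initial, intervalIntegral.integral_sub ((i₁.sub i₂).sub i₃) i₄,
        intervalIntegral.integral_sub (i₁.sub i₂) i₃, intervalIntegral.integral_sub i₁ i₂]
    have hx := hθ.second.smul_const (inner ℝ (S.P x) (S.K ξ) : ℝ)
    refine (hx.sub hU.reflect).congr hT.le (fun t _ => ?_) fun t _ => ?_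
    · simp only [φt, map_sub, map_smul, inner_sub_left, real_inner_smul_left, smul_eq_mul]
    · simp only [φt, φxx, φxxt, F, map_sub, map_smul, map_neg, inner_sub_left, inner_neg_left,
        real_inner_smul_left, smul_eq_mul, sub_sub_cancel]
      ring
  have hP : ∀ (f : L2 ℓ) {v v₁ v₂ : ℝ → ℝ} (hv : IsTest ℓ v v₁ v₂),
      pairing ℓ ρ f v = inner ℝ (S.P f) (S.K (hv.isH2.second.memLp.toLp v₂)) :=
    fun f _ _ _ hv => (inner_mulOp hcoef.rho_memLp f _ (hv.ae_eq hℓ.le)).symm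
  have hQ : ∀ (f : L2 ℓ) {v v₁ v₂ : ℝ → ℝ} (hv : IsTest ℓ v v₁ v₂),
      pairing ℓ μ f v = inner ℝ (S.Q f) (S.K (hv.isH2.second.memLp.toLp v₂)) :=
    fun f _ _ _ hv => (inner_mulOp hcoef.mu_memLp f _ (hv.ae_eq hℓ.le)).symm
  have hR : ∀ (f : L2 ℓ) {v v₁ v₂ : ℝ → ℝ} (hv : IsTest ℓ v v₁ v₂),
      pairing ℓ r f v₂ = inner ℝ (S.R f) (hv.isH2.second.memLp.toLp v₂) :=
    fun f _ _ _ hv =>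
      (inner_mulOp (hcoef.r_memLp hℓ.le) f _ hv.isH2.second.memLp.coeFn_toLp.symm).symm
  have hC : ∀ (f : L2 ℓ) {v v₁ v₂ : ℝ → ℝ} (hv : IsTest ℓ v v₁ v₂),
      pairing ℓ κ f v₂ = inner ℝ (S.C f) (hv.isH2.second.memLp.toLp v₂) :=
    fun f _ _ _ hv =>
      (inner_mulOp (hcoef.kappa_memLp hℓ.le) f _ hv.isH2.second.memLp.coeFn_toLp.symm).symm
  refine ⟨fun t => θ t • x + J (J (Z (T - t))), fun t => θ t • unit ℓ + J (Z (T - t)), φxx, φt,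
    fun t => θ₁ t • unit ℓ + -J (Y (T - t)), φxxt, ?_, fun h₀ => ?_, ?_, ?_, ?_⟩
  · refine ⟨?_, (hθ.first.smul_const _).add (hZ.clm J).reflect, hZ.reflect,
      fun t _ => exists_isH2_lift hℓ.le (θ t) (Z (T - t)), hφt, ?_, ?_, fun v v₁ v₂ hv => ?_⟩
    · simpa only [φt, sub_eq_add_neg] using (hθ.first.smul_const x).add hKZ.reflect
    · simp [hθT, Z]
    · simp [φt, hW.initial]
    · simpa only [hP _ hv, hQ _ hv, hR _ hv, hC _ hv] using hweak (hv.isH2.second.memLp.toLp v₂)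
  -- If `θ₁ T = 0`, all approximating initial data `θ₁ T • z n` vanish and are trivially bounded.
  · obtain ⟨V, hV⟩ := hacc ⟨0, fun n => by simp [h₀]⟩
    have hφtt : IsH1 0 T φt (fun t => θ₂ t • x - -V (T - t)) :=
      (hθ.second.smul_const x).sub hV.reflect
    refine ⟨_, hφtt, fun v v₁ v₂ hv => ?_⟩
    let ξ := hv.isH2.second.memLp.toLp v₂
    have h1 := hφtt.clm (innerSL ℝ (S.K ξ) ∘L S.P)
    simp only [ContinuousLinearMap.comp_apply, innerSL_apply_apply,
      fun y => real_inner_comm y (S.K ξ)] at h1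
    -- The acceleration and the weak form give two derivatives of the same `H¹` function of time,
    -- equal almost everywhere.
    filter_upwards [h1.ae_unique hT.le (hweak ξ)] with t ht
    rw [hP _ hv, hQ _ hv, hR _ hv, hC _ hv]
    linarith
  -- The factor `2` comes from splitting `φt` into lift and `U`; `ℓ ^ 3 / 3` is `‖x‖ ^ 2`.
  · have h1 := integral_norm_sub_sq_le hT.le (hsm x hθ₁)
      (memLp_reflect (memLp_two_of_continuousOn hW.continuousOn))
    rw [integral_reflect (fun t => ‖U t‖ ^ 2)] at h1
    simp only [norm_smul, mul_pow, Real.norm_eq_abs, sq_abs] at h1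
    rw [intervalIntegral.integral_mul_const,
      show ‖x‖ ^ 2 = ℓ ^ 3 / 3 from norm_volterra_unit_sq hℓ.le] at h1
    have h2 : (∫ t in (0 : ℝ)..T, θ₁ t ^ 2) * (ℓ ^ 3 / 3) ≤ G T θ₁ θ₂ * (ℓ ^ 3 / 3) := by
      gcongr
      exact le_add_of_nonneg_right (intervalIntegral.integral_nonneg hT.le fun _ _ => sq_nonneg _)
    have h3 : S.ρ₀ = ρ₀ := rfl
    rw [h3] at b₁
    refine h1.trans ?_
    linarith
  · rw [integral_reflect (fun t => ‖Z t‖ ^ 2)]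
    exact b₂.trans_eq (by change _ / r₀ * Real.exp (T / ρ₀) = _; ring)
  · simp only [φxxt, norm_neg]
    rw [integral_reflect (fun t => ‖Y t‖ ^ 2)]
    exact b₃.trans_eq (by change _ / (2 * κ₀) * Real.exp (T / ρ₀) = _; ring)
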